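/- Let $\xi$ be the entire function that extends $\frac{s(s-1)}{2}\pi^{-s/2}\Gamma(s/2)\zeta(s)$, and put $\Xi(t)=\xi(\tfrac12+it)$ for $t\in\mathbb{C}$. Let $\gamma$ be Euler's constant and $G=\sum_{n=0}^\infty \frac{(-1)^n}{(2n+1)^2}$ Catalan's constant. Then $\zeta(\tfrac12)\neq 0$ and $$\frac{\zeta'(\frac12)}{\zeta(\frac12)}=\frac{\pi}{4}+\frac{\gamma}{2}+\frac{\log(8\pi)}{2}.$$ Moreover, the zeros of $\Xi$ with positive real part can be arranged in an infinite sequence $(\alpha_n)_{n\ge 1}$ with $0<\operatorname{Re}\alpha_1\le\operatorname{Re}\alpha_2\le\cdots$, each zero being repeated according to its multiplicity; and for every such sequence the series $\sum_{n=1}^\infty \alpha_n^{-2}$ converges absolutely and $$\frac{\zeta''(\frac12)}{\zeta(\frac12)}-\Bigl(\frac{\zeta'(\frac12)}{\zeta(\frac12)}\Bigr)^2=8-\frac{\pi^2}{4}-2G+2\sum_{n=1}^\infty\frac{1}{\alpha_n^2}.$$ The Riemann hypothesis is not assumed. -/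

import Mathlib

/-- The Riemann xi function, as an entire function. Since Mathlib's entire function
`completedRiemannZeta₀` equals `π^(-s/2) Γ(s/2) ζ(s) + 1/s + 1/(1-s)` away from the poles, this is the
entire extension of `s (s-1) / 2 * π^(-s/2) Γ(s/2) ζ(s)`; see `xi_eq`, `differentiable_xi`. -/
noncomputable def xi (s : ℂ) : ℂ :=
  (s * (s - 1) * completedRiemannZeta₀ s + 1) / 2

theorem differentiable_xi : Differentiable ℂ xi := by
  unfold xi
  have := differentiable_completedZeta₀
  fun_prop

/-- `xi` is given by the classical formula wherever the latter has no removable singularity. -/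
theorem xi_eq (s : ℂ) (h1 : s ≠ 1) (hG : ∀ n : ℕ, s ≠ -(2 * (n : ℂ))) :
    xi s = s * (s - 1) / 2 * (Real.pi : ℂ) ^ (-s / 2) * Complex.Gamma (s / 2) * riemannZeta s := by
  have h0 : s ≠ 0 := by simpa using hG 0
  have hΓ : Complex.Gamma (s / 2) ≠ 0 := by
    refine Complex.Gamma_ne_zero fun m hm => hG m ?_
    linear_combination 2 * hm
  have hπ : (Real.pi : ℂ) ^ (-s / 2) ≠ 0 := by
    simp [Complex.cpow_eq_zero_iff, Real.pi_ne_zero]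
  have h1' : (1 : ℂ) - s ≠ 0 := sub_ne_zero.mpr h1.symm
  rw [riemannZeta_def_of_ne_zero h0, Complex.Gammaℝ_def, completedRiemannZeta_eq, xi]
  field_simp
  ring

/-- `Ξ(t) = ξ(1/2 + i t)`. -/
noncomputable def Xi (t : ℂ) : ℂ := xi (1 / 2 + Complex.I * t)

/-- `α 0, α 1, …` lists the zeros of `Ξ` with positive real part, by nondecreasing real part, each
zero repeated according to its multiplicity (a point that is not a zero has order `0` and is
therefore not listed). -/
structure IsXiZeroSequence (α : ℕ → ℂ) : Prop where
  re_pos : ∀ n, 0 < (α n).re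
  monotone_re : Monotone fun n => (α n).re
  multiplicity : ∀ z : ℂ, 0 < z.re → {n : ℕ | α n = z}.encard = analyticOrderAt Xi z

/-- Catalan's constant `1 - 1/3² + 1/5² - ⋯`. -/
noncomputable def catalanConstant : ℝ := ∑' n : ℕ, (-1 : ℝ) ^ n / (2 * (n : ℝ) + 1) ^ 2

/-!
The functional equation `ξ (1 - s) = ξ s` forces `ξ' / ξ` to vanish at `1 / 2`, so the logarithmic
derivative of `ξ = s (s - 1) / 2 · π ^ (-s / 2) · Γ (s / 2) · ζ` there expresses `ζ' / ζ (1 / 2)`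
through the digamma value `ψ (1 / 4)`, which the reflection and duplication formulas for `Γ` give.

For the second derivative, `(log Ξ)'' (0) = -∑ 1 / ρ²` over all zeros `ρ` of `Ξ`. This needs only
that `Ξ 0 ≠ 0` and that `Ξ` has order less than `2`: divide out the zeros in the disc of radius `R`
and apply the Borel–Carathéodory inequality to the logarithm of the zero-free quotient; the
remainder tends to `0` as `R → ∞`. Since `Ξ` is even and has no zeros on the imaginary axis, the sum
is twice the sum over the zeros with positive real part, and `ψ' (1 / 4) = ∑ 1 / (n + 1 / 4)²`
equals `π² + 8 G`.

There are infinitely many zeros, because otherwise the same argument would bound `Ξ²` by a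
polynomial, whereas `|ξ (2 n)| ≥ n! / π ^ n`.
-/

section LogDeriv

variable {𝕜 : Type*} [NontriviallyNormedField 𝕜] [CompleteSpace 𝕜] {f g : 𝕜 → 𝕜} {z : 𝕜}

theorem analyticAt_logDeriv (hf : AnalyticAt 𝕜 f z) (hz : f z ≠ 0) :
    AnalyticAt 𝕜 (logDeriv f) z :=
  hf.deriv.div hf hz

theorem deriv_logDeriv_eq (hf : AnalyticAt 𝕜 f z) (hz : f z ≠ 0) :
    deriv (logDeriv f) z = deriv (deriv f) z / f z - (deriv f z / f z) ^ 2 := by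
  rw [logDeriv, deriv_div hf.deriv.differentiableAt hf.differentiableAt hz]
  field_simp

theorem logDeriv_mul_eventuallyEq (hf : AnalyticAt 𝕜 f z) (hg : AnalyticAt 𝕜 g z)
    (hfz : f z ≠ 0) (hgz : g z ≠ 0) :
    logDeriv (fun w => f w * g w) =ᶠ[nhds z] logDeriv f + logDeriv g := by
  filter_upwards [hf.continuousAt.eventually_ne hfz, hg.continuousAt.eventually_ne hgz,
    hf.eventually_analyticAt, hg.eventually_analyticAt] with w hfw hgw hf' hg'
  exact logDeriv_mul w hfw hgw hf'.differentiableAt hg'.differentiableAt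

theorem deriv_logDeriv_mul (hf : AnalyticAt 𝕜 f z) (hg : AnalyticAt 𝕜 g z)
    (hfz : f z ≠ 0) (hgz : g z ≠ 0) :
    deriv (logDeriv fun w => f w * g w) z = deriv (logDeriv f) z + deriv (logDeriv g) z := by
  rw [(logDeriv_mul_eventuallyEq hf hg hfz hgz).deriv_eq]
  exact deriv_add (analyticAt_logDeriv hf hfz).differentiableAt
    (analyticAt_logDeriv hg hgz).differentiableAt

theorem deriv_logDeriv_prod {ι : Type*} (s : Finset ι) {F : ι → 𝕜 → 𝕜}
    (hF : ∀ i ∈ s, AnalyticAt 𝕜 (F i) z) (hFz : ∀ i ∈ s, F i z ≠ 0) :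
    deriv (logDeriv fun w => ∏ i ∈ s, F i w) z = ∑ i ∈ s, deriv (logDeriv (F i)) z := by
  classical
  induction s using Finset.induction_on with
  | empty => simp
  | insert i s hi ih =>
    simp only [Finset.forall_mem_insert] at hF hFz
    simp only [Finset.prod_insert hi, Finset.sum_insert hi]
    rw [deriv_logDeriv_mul hF.1 (Finset.analyticAt_fun_prod s hF.2) hFz.1
      (Finset.prod_ne_zero_iff.2 hFz.2), ih hF.2 hFz.2]

omit [CompleteSpace 𝕜] in
theorem logDeriv_one_sub_div {a : 𝕜} (ha : a ≠ 0) (w : 𝕜) :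
    logDeriv (fun v => 1 - v / a) w = -(a - w)⁻¹ := by
  have hd : deriv (fun v => 1 - v / a) w = -(1 / a) := by simp
  rw [logDeriv_apply, hd, one_sub_div ha, div_div_eq_mul_div, neg_mul, one_div_mul_cancel ha,
    neg_div, one_div]

omit [CompleteSpace 𝕜] in
theorem deriv_logDeriv_one_sub_div {a : 𝕜} (ha : a ≠ 0) (hz : z ≠ a) :
    deriv (logDeriv fun v => 1 - v / a) z = -(1 / (a - z) ^ 2) := by
  rw [funext (logDeriv_one_sub_div ha)]
  have h := ((hasDerivAt_id' z).const_sub a).fun_inv (sub_ne_zero.2 hz.symm)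
  simpa using h.neg.deriv

end LogDeriv

section BorelCaratheodory

open Complex Metric Set
open scoped Nat

variable {g h : ℂ → ℂ} {c : ℂ} {R A : ℝ}

theorem exists_eq_mul_exp_of_ne_zero (hg : DifferentiableOn ℂ g (ball c R))
    (h0 : ∀ z ∈ ball c R, g z ≠ 0) :
    ∃ L : ℂ → ℂ, DifferentiableOn ℂ L (ball c R) ∧ L c = 0 ∧
      ∀ z ∈ ball c R, g z = g c * exp (L z) := by
  obtain ⟨L, hL⟩ := ((hg.deriv isOpen_ball).div hg h0).isExactOn_ball
  refine ⟨fun z => L z - L c,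
    fun z hz => ((hL z hz).sub_const (L c)).differentiableAt.differentiableWithinAt,
    sub_self _, fun z hz => ?_⟩
  have hder : ∀ w ∈ ball c R, HasDerivAt (fun w => g w * exp (-(L w - L c))) 0 w := by
    intro w hw
    have hgw := (hg.differentiableAt (isOpen_ball.mem_nhds hw)).hasDerivAt
    convert! hgw.mul ((hL w hw).sub_const (L c)).neg.cexp using 1
    simp only [Pi.div_apply]
    field_simp [h0 w hw]
    ring
  have hconst : g z * exp (-(L z - L c)) = g c * exp (-(L c - L c)) :=
    isOpen_ball.is_const_of_deriv_eq_zero (convex_ball c R).isPreconnected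
      (fun w hw => (hder w hw).differentiableAt.differentiableWithinAt)
      (fun w hw => (hder w hw).deriv) hz (mem_ball_self (pos_of_mem_ball hz))
  rw [sub_self, neg_zero, exp_zero, mul_one] at hconst
  rw [← hconst, mul_assoc, ← exp_add, neg_add_cancel, exp_zero, mul_one]

theorem norm_iteratedDeriv_le_of_re_le (n : ℕ) (hR : 0 < R) (hA : 0 < A)
    (hh : DifferentiableOn ℂ h (ball c R)) (hc : h c = 0) (hre : ∀ z ∈ ball c R, (h z).re ≤ A) :
    ‖iteratedDeriv n h c‖ ≤ n ! * (2 * A) / (R / 2) ^ n := by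
  have hmaps : MapsTo (fun w => c + w) (ball 0 R) (ball c R) := fun w hw => by
    simpa [mem_ball_iff_norm] using hw
  have hdiff : DifferentiableOn ℂ (fun w => h (c + w)) (ball 0 R) :=
    hh.comp (by fun_prop) hmaps
  have hsphere : ∀ z ∈ sphere c (R / 2), ‖h z‖ ≤ 2 * A := by
    intro z hz
    have hz' : ‖z - c‖ = R / 2 := by simpa [dist_eq_norm] using hz
    have hbc := borelCaratheodory_zero (z := z - c) hA hdiff (fun w hw => hre _ (hmaps hw)) hR
      (by simp [hz', hR]) (by simpa using hc)
    calc ‖h z‖ ≤ 2 * A * (R / 2) / (R - R / 2) := by simpa [hz'] using hbc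
      _ = 2 * A := by rw [sub_half, mul_div_cancel_right₀ _ (half_pos hR).ne']
  refine norm_iteratedDeriv_le_of_forall_mem_sphere_norm_le n (half_pos hR) ?_ hsphere
  apply DifferentiableOn.diffContOnCl
  rw [closure_ball _ (half_pos hR).ne']
  exact hh.mono (closedBall_subset_ball (half_lt_self hR))

theorem norm_deriv_logDeriv_le (hR : 0 < R) (hA : 0 < A) (hg : DifferentiableOn ℂ g (ball c R))
    (h0 : ∀ z ∈ ball c R, g z ≠ 0) (hb : ∀ z ∈ ball c R, ‖g z‖ ≤ Real.exp A * ‖g c‖) :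
    ‖deriv (logDeriv g) c‖ ≤ 16 * A / R ^ 2 := by
  obtain ⟨L, hL, hLc, hgL⟩ := exists_eq_mul_exp_of_ne_zero hg h0
  have hc : c ∈ ball c R := mem_ball_self hR
  have hre : ∀ z ∈ ball c R, (L z).re ≤ A := by
    intro z hz
    have hz' := hb z hz
    rw [hgL z hz, norm_mul, norm_exp, mul_comm] at hz'
    exact Real.exp_le_exp.1 (le_of_mul_le_mul_right hz' (norm_pos_iff.2 (h0 c hc)))
  have hlog : logDeriv g =ᶠ[nhds c] deriv L := by
    filter_upwards [isOpen_ball.mem_nhds hc] with z hz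
    have hg_eq : g =ᶠ[nhds z] fun w => g c * exp (L w) := by
      filter_upwards [isOpen_ball.mem_nhds hz] with w hw using hgL w hw
    have hLz := hL.differentiableAt (isOpen_ball.mem_nhds hz)
    rw [(logDeriv_congr_nhds hg_eq).eq_of_nhds, logDeriv_const_mul _ _ (h0 c hc)]
    rw [logDeriv_apply, hLz.hasDerivAt.cexp.deriv, mul_div_cancel_left₀ _ (exp_ne_zero _)]
  calc ‖deriv (logDeriv g) c‖ = ‖iteratedDeriv 2 L c‖ := by
        rw [hlog.deriv_eq, iteratedDeriv_succ, iteratedDeriv_one]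
    _ ≤ 2 ! * (2 * A) / (R / 2) ^ 2 := norm_iteratedDeriv_le_of_re_le 2 hR hA hL hLc hre
    _ = 16 * A / R ^ 2 := by
      rw [Nat.factorial_two]
      field_simp
      norm_num

end BorelCaratheodory

section Quotient

open Metric

variable {ι : Type*} {β : ι → ℂ} {f g : ℂ → ℂ} {a z w : ℂ} {S : Finset ι}

theorem exists_eq_mul_one_sub_div (hf : Differentiable ℂ f) (ha : a ≠ 0) (hfa : f a = 0) :
    ∃ g : ℂ → ℂ, Differentiable ℂ g ∧ ∀ z, f z = g z * (1 - z / a) := by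
  have hslope : Differentiable ℂ (dslope f a) := by
    rw [← differentiableOn_univ] at hf ⊢
    exact (Complex.differentiableOn_dslope Filter.univ_mem).2 hf
  refine ⟨fun z => -a * dslope f a z, hslope.const_mul _, fun z => ?_⟩
  have hfz : (z - a) * dslope f a z = f z := by simpa [hfa] using sub_smul_dslope f a z
  rw [← hfz]
  field_simp
  ring

theorem analyticOrderAt_one_sub_div (ha : a ≠ 0) (w : ℂ) :
    analyticOrderAt (fun z => 1 - z / a) w = if a = w then 1 else 0 := by
  split_ifs with h
  · subst h
    exact AnalyticAt.analyticOrderAt_eq_one_of_zero_deriv_ne_zero (by fun_prop) (by simp [ha])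
      (by simp [ha])
  · refine analyticOrderAt_eq_zero.2 (.inr (sub_ne_zero.2 fun h' => h ?_))
    rw [eq_div_iff ha, one_mul] at h'
    exact h'

theorem analyticOrderAt_prod_one_sub_div (hβ : ∀ i ∈ S, β i ≠ 0) (w : ℂ) :
    analyticOrderAt (fun z => ∏ i ∈ S, (1 - z / β i)) w = (S.filter (β · = w)).card := by
  classical
  induction S using Finset.induction_on with
  | empty => simp [analyticOrderAt_eq_zero]
  | insert a S ha ih =>
    rw [Finset.forall_mem_insert] at hβ
    simp only [Finset.prod_insert ha, Finset.filter_insert]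
    rw [← Pi.mul_def, analyticOrderAt_mul (by fun_prop)
      (Differentiable.analyticAt (by fun_prop) w), ih hβ.2, analyticOrderAt_one_sub_div hβ.1]
    split_ifs with h
    · rw [Finset.card_insert_of_notMem (by simp [ha]), Nat.cast_add_one, add_comm]
    · rw [zero_add]

theorem analyticOrderAt_eq_add_card (hg : Differentiable ℂ g) (hβ : ∀ i ∈ S, β i ≠ 0)
    (hfg : ∀ z, f z = g z * ∏ i ∈ S, (1 - z / β i)) (w : ℂ) :
    analyticOrderAt f w = analyticOrderAt g w + (S.filter (β · = w)).card := by
  rw [← analyticOrderAt_prod_one_sub_div hβ w, ← analyticOrderAt_mul (hg.analyticAt w)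
    (Differentiable.analyticAt (by fun_prop) w), Pi.mul_def, ← funext hfg]

theorem exists_eq_mul_prod (hf : Differentiable ℂ f) (hβ : ∀ i ∈ S, β i ≠ 0)
    (hS : ∀ w, (S.filter (β · = w)).card ≤ analyticOrderAt f w) :
    ∃ g : ℂ → ℂ, Differentiable ℂ g ∧ ∀ z, f z = g z * ∏ i ∈ S, (1 - z / β i) := by
  classical
  induction S using Finset.induction_on with
  | empty => exact ⟨f, hf, by simp⟩
  | insert a S ha ih =>
    rw [Finset.forall_mem_insert] at hβ
    obtain ⟨g, hg, hfg⟩ := ih hβ.2 fun w =>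
      le_trans (by gcongr; exact Finset.subset_insert _ _) (hS w)
    have hga : g (β a) = 0 := by
      refine apply_eq_zero_of_analyticOrderAt_ne_zero fun h0 => ?_
      have hcard := hS (β a)
      rw [analyticOrderAt_eq_add_card hg hβ.2 hfg, h0, zero_add, Finset.filter_insert,
        if_pos rfl, Finset.card_insert_of_notMem (by simp [ha]), Nat.cast_le] at hcard
      omega
    obtain ⟨k, hk, hgk⟩ := exists_eq_mul_one_sub_div hg hβ.1 hga
    exact ⟨k, hk, fun z => by rw [hfg, hgk, Finset.prod_insert ha, mul_assoc]⟩

theorem le_norm_one_sub_div {ρ R : ℝ} (ha : a ≠ 0) (hρ : -1 ≤ ρ) (haR : ‖a‖ ≤ R)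
    (hw : ‖w‖ = (ρ + 1) * R) : ρ ≤ ‖1 - w / a‖ := by
  have hdiv : ρ + 1 ≤ ‖w / a‖ := by
    rw [norm_div, hw, le_div_iff₀ (norm_pos_iff.2 ha)]
    gcongr
    linarith
  have htri : ‖w / a‖ - ‖(1 : ℂ)‖ ≤ ‖1 - w / a‖ := by
    rw [norm_sub_rev]
    exact norm_sub_norm_le _ _
  rw [norm_one] at htri
  linarith

theorem norm_mul_pow_card_le_of_eq_mul_prod (hg : Differentiable ℂ g) (hβ : ∀ i ∈ S, β i ≠ 0)
    (hfg : ∀ z, f z = g z * ∏ i ∈ S, (1 - z / β i)) {R ρ M : ℝ} (hR : 0 < R) (hρ : 0 < ρ)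
    (hβR : ∀ i ∈ S, ‖β i‖ ≤ R) (hM : ∀ w ∈ sphere (0 : ℂ) ((ρ + 1) * R), ‖f w‖ ≤ M)
    (hz : z ∈ closedBall (0 : ℂ) ((ρ + 1) * R)) : ‖g z‖ * ρ ^ S.card ≤ M := by
  have hr : (ρ + 1) * R ≠ 0 := by positivity
  rw [← le_div_iff₀ (pow_pos hρ _)]
  refine Complex.norm_le_of_forall_mem_frontier_norm_le isBounded_ball hg.diffContOnCl
    (fun w hw => ?_) (by rwa [closure_ball _ hr])
  rw [frontier_ball _ hr] at hw
  rw [le_div_iff₀ (pow_pos hρ _)]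
  calc ‖g w‖ * ρ ^ S.card = ‖g w‖ * ∏ _i ∈ S, ρ := by rw [Finset.prod_const]
    _ ≤ ‖g w‖ * ∏ i ∈ S, ‖1 - w / β i‖ := by
      gcongr with i hi
      exact le_norm_one_sub_div (hβ i hi) (by linarith) (hβR i hi) (by simpa using hw)
    _ = ‖f w‖ := by rw [hfg, norm_mul, norm_prod]
    _ ≤ M := hM w hw

end Quotient

/-- The family `β` lists the zeros of `f`, each repeated according to its multiplicity. -/
def IsZeroFamily {ι : Type*} (f : ℂ → ℂ) (β : ι → ℂ) : Prop :=
  ∀ w, {i | β i = w}.encard = analyticOrderAt f w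

namespace IsZeroFamily

open Metric

variable {ι : Type*} {β : ι → ℂ} {f g : ℂ → ℂ} {z w : ℂ} {S : Finset ι} {R : ℝ}

theorem ne_zero (h : IsZeroFamily f β) (hf0 : f 0 ≠ 0) (i : ι) : β i ≠ 0 := by
  intro hi
  have hempty := h 0
  rw [analyticOrderAt_eq_zero.2 (.inr hf0), Set.encard_eq_zero] at hempty
  exact Set.notMem_empty i (hempty ▸ hi)

theorem card_filter_le (h : IsZeroFamily f β) (S : Finset ι) (w : ℂ) :
    (S.filter (β · = w)).card ≤ analyticOrderAt f w := by
  rw [← h w, ← Set.encard_coe_eq_coe_finsetCard]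
  exact Set.encard_le_encard fun i hi => (Finset.mem_filter.1 hi).2

theorem exists_eq_mul_prod (h : IsZeroFamily f β) (hf : Differentiable ℂ f) (hf0 : f 0 ≠ 0)
    (S : Finset ι) :
    ∃ g : ℂ → ℂ, Differentiable ℂ g ∧ ∀ z, f z = g z * ∏ i ∈ S, (1 - z / β i) :=
  _root_.exists_eq_mul_prod hf (fun i _ => h.ne_zero hf0 i) (h.card_filter_le S)

theorem quotient_ne_zero (h : IsZeroFamily f β) (hf0 : f 0 ≠ 0) (hg : Differentiable ℂ g)
    (hfg : ∀ z, f z = g z * ∏ i ∈ S, (1 - z / β i)) (hS : ∀ i, β i = w → i ∈ S) : g w ≠ 0 := by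
  have hfilter : {i | β i = w} = (S.filter (β · = w) : Finset ι) := by
    ext i
    simpa using hS i
  have horder := analyticOrderAt_eq_add_card hg (fun i _ => h.ne_zero hf0 i) hfg w
  rw [← h w, hfilter, Set.encard_coe_eq_coe_finsetCard] at horder
  have hcancel : 0 = analyticOrderAt g w :=
    ENat.add_left_injective_of_ne_top (ENat.natCast_ne_top _) ((zero_add _).trans horder)
  exact (hg.analyticAt w).analyticOrderAt_eq_zero.1 hcancel.symm

theorem norm_mul_pow_card_le (h : IsZeroFamily f β) (hf : Differentiable ℂ f) (hf0 : f 0 ≠ 0)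
    {ρ M : ℝ} (hR : 0 < R) (hρ : 0 < ρ) (hS : ∀ i ∈ S, ‖β i‖ ≤ R)
    (hM : ∀ w ∈ sphere (0 : ℂ) ((ρ + 1) * R), ‖f w‖ ≤ M) : ‖f 0‖ * ρ ^ S.card ≤ M := by
  obtain ⟨g, hg, hfg⟩ := h.exists_eq_mul_prod hf hf0 S
  have hfg0 : f 0 = g 0 := by simpa using hfg 0
  rw [hfg0]
  exact norm_mul_pow_card_le_of_eq_mul_prod hg (fun i _ => h.ne_zero hf0 i) hfg hR hρ hS hM
    (mem_closedBall_self (by positivity))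

theorem card_le (h : IsZeroFamily f β) (hf : Differentiable ℂ f) (hf0 : f 0 ≠ 0) {M : ℝ}
    (hR : 0 < R) (hS : ∀ i ∈ S, ‖β i‖ ≤ R)
    (hM : ∀ w ∈ sphere (0 : ℂ) (3 * R), ‖f w‖ ≤ Real.exp M) :
    (S.card : ℝ) ≤ (M - Real.log ‖f 0‖) / Real.log 2 := by
  have hpos : 0 < ‖f 0‖ := norm_pos_iff.2 hf0
  have hle := h.norm_mul_pow_card_le (ρ := 2) hf hf0 hR two_pos hS (by norm_num; simpa using hM)
  have hlog := Real.log_le_log (by positivity) hle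
  rw [Real.log_mul hpos.ne' (by positivity), Real.log_pow, Real.log_exp] at hlog
  rw [le_div_iff₀ (Real.log_pos one_lt_two)]
  linarith

theorem finite_norm_le (h : IsZeroFamily f β) (hf : Differentiable ℂ f) (hf0 : f 0 ≠ 0)
    (R : ℝ) : {i | ‖β i‖ ≤ R}.Finite := by
  rcases le_or_gt R 0 with hR | hR
  · refine Set.finite_empty.subset fun i hi => ?_
    exact h.ne_zero hf0 i (norm_le_zero_iff.1 (hi.trans hR))
  obtain ⟨M, hM⟩ := (isCompact_sphere (0 : ℂ) (3 * R)).exists_bound_of_continuousOn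
    hf.continuous.continuousOn
  have hM' : ∀ w ∈ sphere (0 : ℂ) (3 * R), ‖f w‖ ≤ Real.exp M := fun w hw =>
    (hM w hw).trans ((le_add_of_nonneg_right zero_le_one).trans (Real.add_one_le_exp M))
  by_contra hinf
  obtain ⟨N, hN⟩ := exists_nat_gt ((M - Real.log ‖f 0‖) / Real.log 2)
  obtain ⟨S, hS, rfl⟩ := Set.Infinite.exists_subset_card_eq hinf N
  exact hN.not_ge (h.card_le hf hf0 hR (fun i hi => hS hi) hM')

end IsZeroFamily

/-- Growth of order at most `p`. The bound uses `1 + ‖z‖` rather than `‖z‖`, so that it can hold on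
the whole plane. -/
def HasExpGrowth (f : ℂ → ℂ) (p : ℝ) : Prop :=
  ∃ C, 0 ≤ C ∧ ∀ z, ‖f z‖ ≤ Real.exp (C * (1 + ‖z‖) ^ p)

namespace HasExpGrowth

open Metric

variable {f g : ℂ → ℂ} {p a : ℝ}

theorem exists_norm_le (hf : HasExpGrowth f p) (hp : 0 ≤ p) (ha : 0 ≤ a) :
    ∃ C, 0 ≤ C ∧ ∀ T, 0 ≤ T → ∀ z, 1 + ‖z‖ ≤ a * T → ‖f z‖ ≤ Real.exp (C * T ^ p) := by
  obtain ⟨C, hC, hfC⟩ := hf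
  refine ⟨C * a ^ p, by positivity, fun T hT z hz => (hfC z).trans ?_⟩
  rw [mul_assoc, ← Real.mul_rpow ha hT]
  gcongr

theorem of_forall_norm_le (hf : HasExpGrowth f p) (hp : 0 ≤ p) (ha : 0 ≤ a)
    (h : ∀ z M, (∀ w, ‖w‖ ≤ a * (1 + ‖z‖) → ‖f w‖ ≤ M) → ‖g z‖ ≤ M) : HasExpGrowth g p := by
  obtain ⟨C, hC, hfC⟩ := hf.exists_norm_le hp (a := 1 + a) (by positivity)
  refine ⟨C, hC, fun z => h z _ fun w hw => hfC _ (by positivity) w ?_⟩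
  linarith [norm_nonneg z]

theorem comp_add_const (hf : HasExpGrowth f p) (hp : 0 ≤ p) (c : ℂ) :
    HasExpGrowth (fun z => f (z + c)) p := by
  refine hf.of_forall_norm_le hp (a := 1 + ‖c‖) (by positivity) fun z M hM => hM _ ?_
  nlinarith [norm_add_le z c, norm_nonneg z, norm_nonneg c]

theorem of_eq_mul_prod {ι : Type*} {β : ι → ℂ} {S : Finset ι} (hf : HasExpGrowth f p)
    (hp : 0 ≤ p) (hg : Differentiable ℂ g) (hβ : ∀ i ∈ S, β i ≠ 0)
    (hfg : ∀ z, f z = g z * ∏ i ∈ S, (1 - z / β i)) : HasExpGrowth g p := by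
  have hsum : 0 ≤ ∑ i ∈ S, ‖β i‖ := Finset.sum_nonneg fun i _ => norm_nonneg _
  refine hf.of_forall_norm_le hp (a := 2 * (1 + ∑ i ∈ S, ‖β i‖)) (by positivity)
    fun z M hM => ?_
  set R := (1 + ∑ i ∈ S, ‖β i‖) * (1 + ‖z‖)
  have hβR : ∀ i ∈ S, ‖β i‖ ≤ R := fun i hi => by
    have hi' := Finset.single_le_sum (fun j _ => norm_nonneg (β j)) hi
    nlinarith [norm_nonneg z]
  have hzR : ‖z‖ ≤ (1 + 1) * R := by nlinarith [norm_nonneg z]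
  simpa using norm_mul_pow_card_le_of_eq_mul_prod (M := M) hg hβ hfg (by positivity) one_pos hβR
    (fun w hw => hM w (by rw [mem_sphere_zero_iff_norm.1 hw]; linarith)) (by simpa using hzR)

end HasExpGrowth

section Summability

open Finset

theorem summable_rpow_neg_of_card_le {ι : Type*} {v : ι → ℝ} {D p q : ℝ} (hv : ∀ i, 1 ≤ v i)
    (hpq : p < q) (hq : 0 ≤ q)
    (hD : ∀ T, 1 ≤ T → ∀ S : Finset ι, (∀ i ∈ S, v i ≤ T) → (#S : ℝ) ≤ D * T ^ p) :
    Summable fun i => v i ^ (-q) := by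
  classical
  have hD0 : 0 ≤ D := by simpa using hD 1 le_rfl ∅ (by simp)
  choose k hk1 hk2 using fun i => exists_nat_pow_near (hv i) one_lt_two
  have hgeo : Summable fun n : ℕ => ((2 : ℝ) ^ (p - q)) ^ n :=
    summable_geometric_of_lt_one (by positivity)
      (Real.rpow_lt_one_of_one_lt_of_neg one_lt_two (by linarith))
  have hblock : ∀ (u : Finset ι) (n : ℕ), ∑ i ∈ u with k i = n, v i ^ (-q)
      ≤ D * 2 ^ p * ((2 : ℝ) ^ (p - q)) ^ n := by
    intro u n
    have hcard : (#{i ∈ u | k i = n} : ℝ) ≤ D * ((2 : ℝ) ^ (n + 1)) ^ p :=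
      hD _ (one_le_pow₀ one_le_two) _ fun i hi => (Finset.mem_filter.1 hi).2 ▸ (hk2 i).le
    calc ∑ i ∈ u with k i = n, v i ^ (-q) ≤ ∑ i ∈ u with k i = n, ((2 : ℝ) ^ n) ^ (-q) := by
          refine sum_le_sum fun i hi => Real.rpow_le_rpow_of_nonpos (by positivity) ?_ (by linarith)
          exact (Finset.mem_filter.1 hi).2 ▸ hk1 i
      _ = #{i ∈ u | k i = n} * ((2 : ℝ) ^ n) ^ (-q) := by rw [sum_const, nsmul_eq_mul]
      _ ≤ D * ((2 : ℝ) ^ (n + 1)) ^ p * ((2 : ℝ) ^ n) ^ (-q) := by gcongr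
      _ = D * 2 ^ p * ((2 : ℝ) ^ (p - q)) ^ n := by
        rw [Real.rpow_pow_comm two_pos.le, sub_eq_add_neg, Real.rpow_add (by positivity), pow_succ,
          Real.mul_rpow (by positivity) two_pos.le]
        ring
  refine summable_of_sum_le (c := D * 2 ^ p * ∑' n : ℕ, ((2 : ℝ) ^ (p - q)) ^ n)
    (fun i => Real.rpow_nonneg (zero_le_one.trans (hv i)) _) fun u => ?_
  calc ∑ i ∈ u, v i ^ (-q) = ∑ n ∈ u.image k, ∑ i ∈ u with k i = n, v i ^ (-q) :=
        (sum_fiberwise_of_maps_to (fun i hi => mem_image_of_mem k hi) _).symm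
    _ ≤ ∑ n ∈ u.image k, D * 2 ^ p * ((2 : ℝ) ^ (p - q)) ^ n := sum_le_sum fun n _ => hblock u n
    _ = D * 2 ^ p * ∑ n ∈ u.image k, ((2 : ℝ) ^ (p - q)) ^ n := by rw [mul_sum]
    _ ≤ D * 2 ^ p * ∑' n : ℕ, ((2 : ℝ) ^ (p - q)) ^ n := by
      gcongr
      exact hgeo.sum_le_tsum _ fun n _ => by positivity

end Summability

open Filter Topology in
theorem tendsto_rpow_add_div_sq {p : ℝ} (hp2 : p < 2) (C K : ℝ) :
    Tendsto (fun R : ℝ => 16 * (C * R ^ p + K) / R ^ 2) atTop (𝓝 0) := by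
  have hrpow : Tendsto (fun R : ℝ => R ^ (p - 2)) atTop (𝓝 0) := by
    simpa using tendsto_rpow_neg_atTop (sub_pos.2 hp2)
  have hinv : Tendsto (fun R : ℝ => (R ^ 2)⁻¹) atTop (𝓝 0) :=
    tendsto_inv_atTop_zero.comp (tendsto_pow_atTop two_ne_zero)
  have hlim := (hrpow.const_mul (16 * C)).add (hinv.const_mul (16 * K))
  rw [mul_zero, mul_zero, add_zero] at hlim
  refine hlim.congr' ?_
  filter_upwards [eventually_gt_atTop 0] with R hR
  rw [Real.rpow_sub hR, Real.rpow_two]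
  field_simp

namespace IsZeroFamily

open Filter Topology Metric

variable {ι : Type*} {β : ι → ℂ} {f : ℂ → ℂ} {p q R M : ℝ} {S : Finset ι}

theorem exists_card_le (h : IsZeroFamily f β) (hf : Differentiable ℂ f) (hf0 : f 0 ≠ 0)
    (hp : 0 ≤ p) (hgr : HasExpGrowth f p) :
    ∃ D, ∀ T, 1 ≤ T → ∀ S : Finset ι, (∀ i ∈ S, ‖β i‖ ≤ T) → (S.card : ℝ) ≤ D * T ^ p := by
  obtain ⟨C, -, hC⟩ := hgr.exists_norm_le hp (a := 4) (by norm_num)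
  refine ⟨(C + |Real.log ‖f 0‖|) / Real.log 2, fun T hT S hS => ?_⟩
  have hcard := h.card_le hf hf0 (zero_lt_one.trans_le hT) hS fun w hw =>
    hC T (zero_le_one.trans hT) w (by rw [mem_sphere_zero_iff_norm.1 hw]; linarith)
  refine hcard.trans ?_
  rw [div_mul_eq_mul_div, add_mul, sub_eq_add_neg]
  gcongr
  exact (neg_le_abs _).trans (le_mul_of_one_le_right (abs_nonneg _) (Real.one_le_rpow hT hp))

theorem summable_norm_rpow_neg (h : IsZeroFamily f β) (hf : Differentiable ℂ f) (hf0 : f 0 ≠ 0)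
    (hp : 0 ≤ p) (hpq : p < q) (hgr : HasExpGrowth f p) : Summable fun i => ‖β i‖ ^ (-q) := by
  obtain ⟨D, hD⟩ := h.exists_card_le hf hf0 hp hgr
  have hmax : Summable fun i => max 1 ‖β i‖ ^ (-q) :=
    summable_rpow_neg_of_card_le (fun i => le_max_left _ _) hpq (hp.trans hpq.le)
      fun T hT S hS => hD T hT S fun i hi => (le_max_right _ _).trans (hS i hi)
  refine (summable_congr_cofinite ?_).1 hmax
  filter_upwards [(h.finite_norm_le hf hf0 1).compl_mem_cofinite] with i hi
  have hi' : 1 < ‖β i‖ := by simpa using hi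
  rw [max_eq_right hi'.le]

theorem summable_one_div_sq (h : IsZeroFamily f β) (hf : Differentiable ℂ f) (hf0 : f 0 ≠ 0)
    (hp : 0 ≤ p) (hp2 : p < 2) (hgr : HasExpGrowth f p) : Summable fun i => 1 / β i ^ 2 := by
  refine Summable.of_norm ((h.summable_norm_rpow_neg hf hf0 hp hp2 hgr).congr fun i => ?_)
  rw [Real.rpow_neg (norm_nonneg _), Real.rpow_two, norm_div, norm_one, norm_pow, one_div]

theorem norm_deriv_logDeriv_add_sum_le (h : IsZeroFamily f β) (hf : Differentiable ℂ f)
    (hf0 : f 0 ≠ 0) (hR : 0 < R) (hS : ∀ i, i ∈ S ↔ ‖β i‖ ≤ R)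
    (hM : ∀ w ∈ sphere (0 : ℂ) (2 * R), ‖f w‖ ≤ Real.exp M) (hM0 : 0 ≤ M) :
    ‖deriv (logDeriv f) 0 + ∑ i ∈ S, 1 / β i ^ 2‖
      ≤ 16 * (M + (|Real.log ‖f 0‖| + 1)) / R ^ 2 := by
  have hne := h.ne_zero hf0
  obtain ⟨g, hg, hfg⟩ := h.exists_eq_mul_prod hf hf0 S
  have hfg0 : f 0 = g 0 := by simpa using hfg 0
  have hlog : deriv (logDeriv f) 0 + ∑ i ∈ S, 1 / β i ^ 2 = deriv (logDeriv g) 0 := by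
    rw [funext hfg, deriv_logDeriv_mul (hg.analyticAt 0) (Differentiable.analyticAt (by fun_prop) 0)
      (hfg0 ▸ hf0) (by simp), deriv_logDeriv_prod S (fun i _ => by fun_prop) (by simp),
      Finset.sum_congr rfl fun i _ => deriv_logDeriv_one_sub_div (hne i) (hne i).symm]
    simp
  rw [hlog]
  refine norm_deriv_logDeriv_le hR (by positivity) hg.differentiableOn (fun w hw => ?_)
    fun w hw => ?_
  · refine h.quotient_ne_zero hf0 hg hfg fun i hi => (hS i).2 ?_
    rw [hi]
    exact (mem_ball_zero_iff.1 hw).le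
  · have hgw : ‖g w‖ ≤ Real.exp M := by
      simpa using norm_mul_pow_card_le_of_eq_mul_prod (ρ := 1) hg (fun i _ => hne i) hfg hR one_pos
        (fun i hi => (hS i).1 hi) (by norm_num; simpa using hM)
        (ball_subset_closedBall (ball_subset_ball (by linarith) hw))
    rw [← hfg0]
    refine hgw.trans ?_
    rw [← Real.exp_log (norm_pos_iff.2 hf0), ← Real.exp_add, Real.exp_le_exp, Real.log_exp]
    linarith [neg_abs_le (Real.log ‖f 0‖)]

theorem deriv_logDeriv_eq_neg_tsum (h : IsZeroFamily f β) (hf : Differentiable ℂ f)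
    (hf0 : f 0 ≠ 0) (hp : 0 ≤ p) (hp2 : p < 2) (hgr : HasExpGrowth f p) :
    deriv (logDeriv f) 0 = -∑' i, 1 / β i ^ 2 := by
  classical
  obtain ⟨C, hC, hfC⟩ := hgr.exists_norm_le hp (a := 3) (by norm_num)
  set S : ℝ → Finset ι := fun R => (h.finite_norm_le hf hf0 R).toFinset
  have hS : ∀ R i, i ∈ S R ↔ ‖β i‖ ≤ R := by simp [S]
  have hS_top : Tendsto S atTop atTop :=
    tendsto_atTop_finset_of_monotone (fun R R' hR i hi => (hS R' i).2 (((hS R i).1 hi).trans hR))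
      fun i => ⟨‖β i‖, (hS _ i).2 le_rfl⟩
  have hsum : Tendsto (fun R => deriv (logDeriv f) 0 + ∑ i ∈ S R, 1 / β i ^ 2) atTop
      (𝓝 (deriv (logDeriv f) 0 + ∑' i, 1 / β i ^ 2)) :=
    ((h.summable_one_div_sq hf hf0 hp hp2 hgr).hasSum.comp hS_top).const_add _
  have hbound : ∀ᶠ R in atTop, ‖deriv (logDeriv f) 0 + ∑ i ∈ S R, 1 / β i ^ 2‖
      ≤ 16 * (C * R ^ p + (|Real.log ‖f 0‖| + 1)) / R ^ 2 := by
    filter_upwards [eventually_ge_atTop 1] with R hR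
    have hR0 : 0 < R := zero_lt_one.trans_le hR
    refine h.norm_deriv_logDeriv_add_sum_le hf hf0 hR0 (hS R) (fun w hw => ?_) (by positivity)
    exact hfC R hR0.le w (by rw [mem_sphere_zero_iff_norm.1 hw]; linarith)
  have hzero := squeeze_zero_norm' hbound (tendsto_rpow_add_div_sq hp2 C _)
  exact eq_neg_of_add_eq_zero_left (tendsto_nhds_unique hsum hzero)

end IsZeroFamily

section FiniteZeros

variable {f g : ℂ → ℂ} {p : ℝ}

theorem deriv_logDeriv_eq_zero_of_ne_zero (hg : Differentiable ℂ g) (h0 : ∀ z, g z ≠ 0)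
    (hp : 0 ≤ p) (hp2 : p < 2) (hgr : HasExpGrowth g p) (c : ℂ) : deriv (logDeriv g) c = 0 := by
  have hg' : Differentiable ℂ fun z => g (z + c) := by fun_prop
  have hempty : IsZeroFamily (fun z => g (z + c)) (Empty.elim : Empty → ℂ) := fun w => by
    have horder : analyticOrderAt (fun z => g (z + c)) w = 0 :=
      analyticOrderAt_eq_zero.2 (.inr (h0 _))
    rw [horder, Set.eq_empty_of_isEmpty {i | _ = w}, Set.encard_empty]
  have hlog : (fun z => logDeriv g (z + c)) = logDeriv fun z => g (z + c) := by
    ext z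
    rw [logDeriv_apply, logDeriv_apply, deriv_comp_add_const]
  have hformula := hempty.deriv_logDeriv_eq_neg_tsum hg' (h0 _) hp hp2 (hgr.comp_add_const hp c)
  rw [← hlog, deriv_comp_add_const, zero_add, tsum_empty, neg_zero] at hformula
  exact hformula

theorem mul_comp_neg_eq_sq_of_ne_zero (hg : Differentiable ℂ g) (h0 : ∀ z, g z ≠ 0)
    (hp : 0 ≤ p) (hp2 : p < 2) (hgr : HasExpGrowth g p) (z : ℂ) : g z * g (-z) = g 0 ^ 2 := by
  have hlog : ∀ w, logDeriv g w = logDeriv g 0 := fun w =>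
    is_const_of_deriv_eq_zero
      (fun w => (analyticAt_logDeriv (hg.analyticAt w) (h0 w)).differentiableAt)
      (deriv_logDeriv_eq_zero_of_ne_zero hg h0 hp hp2 hgr) w 0
  have hderiv : ∀ w, deriv g w = logDeriv g 0 * g w := fun w => by
    rw [← hlog w, logDeriv_apply, div_mul_cancel₀ _ (h0 w)]
  have hprod : ∀ w, HasDerivAt (fun w => g w * g (-w)) 0 w := fun w => by
    convert! (hg w).hasDerivAt.mul ((hg (-w)).hasDerivAt.scomp w (hasDerivAt_neg w)) using 1
    rw [hderiv, hderiv, neg_one_smul, Function.comp_apply]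
    ring
  have hconst := is_const_of_deriv_eq_zero (fun w => (hprod w).differentiableAt)
    (fun w => (hprod w).deriv) z 0
  rw [hconst, neg_zero, sq]

theorem norm_prod_one_sub_div_le {ι : Type*} (S : Finset ι) (β : ι → ℂ) (z : ℂ) :
    ‖∏ i ∈ S, (1 - z / β i)‖ ≤ (∏ i ∈ S, (1 + ‖β i‖⁻¹)) * (1 + ‖z‖) ^ S.card := by
  rw [norm_prod, ← Finset.prod_const, ← Finset.prod_mul_distrib]
  refine Finset.prod_le_prod (fun i _ => norm_nonneg _) fun i _ => ?_
  calc ‖1 - z / β i‖ ≤ 1 + ‖z‖ * ‖β i‖⁻¹ := by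
        simpa [div_eq_mul_inv] using norm_sub_le 1 (z / β i)
    _ ≤ (1 + ‖β i‖⁻¹) * (1 + ‖z‖) := by
      nlinarith [norm_nonneg z, inv_nonneg.2 (norm_nonneg (β i))]

theorem IsZeroFamily.exists_norm_sq_le_of_finite {ι : Type*} [Finite ι] {β : ι → ℂ}
    (h : IsZeroFamily f β) (hf : Differentiable ℂ f) (hf0 : f 0 ≠ 0) (heven : Function.Even f)
    (hp : 0 ≤ p) (hp2 : p < 2) (hgr : HasExpGrowth f p) :
    ∃ K : ℝ, ∃ n : ℕ, ∀ z, ‖f z‖ ^ 2 ≤ K * (1 + ‖z‖) ^ n := by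
  have := Fintype.ofFinite ι
  obtain ⟨g, hg, hfg⟩ := h.exists_eq_mul_prod hf hf0 Finset.univ
  have hg0 : ∀ z, g z ≠ 0 := fun z =>
    h.quotient_ne_zero hf0 hg hfg fun i _ => Finset.mem_univ i
  have hg_growth := hgr.of_eq_mul_prod hp hg (fun i _ => h.ne_zero hf0 i) hfg
  set P : ℂ → ℂ := fun z => ∏ i, (1 - z / β i)
  set c : ℝ := ∏ i, (1 + ‖β i‖⁻¹)
  have hc : 0 ≤ c := Finset.prod_nonneg fun i _ => by positivity
  refine ⟨‖g 0‖ ^ 2 * c ^ 2, 2 * Fintype.card ι, fun z => ?_⟩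
  have hP : ∀ w, ‖P w‖ ≤ c * (1 + ‖w‖) ^ Fintype.card ι := norm_prod_one_sub_div_le _ β
  have hPneg : ‖P (-z)‖ ≤ c * (1 + ‖z‖) ^ Fintype.card ι := by simpa using hP (-z)
  calc ‖f z‖ ^ 2 = ‖f z * f (-z)‖ := by rw [heven, ← sq, norm_pow]
    _ = ‖(g z * g (-z)) * (P z * P (-z))‖ := by rw [hfg z, hfg (-z), mul_mul_mul_comm]
    _ = ‖g 0‖ ^ 2 * (‖P z‖ * ‖P (-z)‖) := by
      rw [mul_comp_neg_eq_sq_of_ne_zero hg hg0 hp hp2 hg_growth, norm_mul, norm_pow, norm_mul]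
    _ ≤ ‖g 0‖ ^ 2 * ((c * (1 + ‖z‖) ^ Fintype.card ι) * (c * (1 + ‖z‖) ^ Fintype.card ι)) := by
      gcongr
      exact hP z
    _ = ‖g 0‖ ^ 2 * c ^ 2 * (1 + ‖z‖) ^ (2 * Fintype.card ι) := by ring

end FiniteZeros

section Enumeration

theorem nonempty_orderIso_nat {ι : Type*} [LinearOrder ι] [Infinite ι]
    (h : ∀ i : ι, (Set.Iio i).Finite) : Nonempty (ℕ ≃o ι) := by
  classical
  let rank : ι → ℕ := fun i => (Set.Iio i).ncard
  have hrank : StrictMono rank := fun i j hij =>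
    Set.ncard_lt_ncard (Set.Iio_ssubset_Iio hij) (h j)
  have : Infinite (Set.range rank) := (Set.infinite_range_of_injective hrank.injective).to_subtype
  exact ⟨(Nat.Subtype.orderIsoOfNat (Set.range rank)).trans (hrank.orderIso rank).symm⟩

theorem countable_of_finite_le {ι : Type*} {v : ι → ℝ} (hv : ∀ R : ℝ, {i | v i ≤ R}.Finite) :
    Countable ι := by
  rw [← Set.countable_univ_iff]
  refine (Set.countable_iUnion fun n : ℕ => (hv n).countable).mono fun i _ => ?_
  exact Set.mem_iUnion.2 (exists_nat_ge (v i))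

theorem exists_equiv_nat_monotone {ι : Type*} [Infinite ι] (v : ι → ℝ)
    (hv : ∀ R : ℝ, {i | v i ≤ R}.Finite) : ∃ e : ℕ ≃ ι, Monotone (v ∘ e) := by
  have := countable_of_finite_le hv
  obtain ⟨c, hc⟩ := exists_injective_nat ι
  -- Ties in `v` are broken by the injection `c`, which turns `ι` into a linear order.
  let key : ι → ℝ ×ₗ ℕ := fun i => toLex (v i, c i)
  have hkey : Function.Injective key := fun i j h => hc (congrArg Prod.snd (toLex.injective h))
  have hle : ∀ i j, key i ≤ key j → v i ≤ v j := fun i j h =>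
    (Prod.Lex.le_iff.1 h).elim le_of_lt fun h => h.1.le
  let _ : LinearOrder ι := LinearOrder.lift' key hkey
  obtain ⟨e⟩ := nonempty_orderIso_nat fun i =>
    (hv (v i)).subset fun j (hj : j < i) => hle j i hj.le
  exact ⟨e.toEquiv, fun m n hmn => hle _ _ (e.monotone hmn)⟩

theorem encard_sigma_fst_eq {α : Type*} {s : Set α} (m : α → ℕ) {a : α} (ha : a ∈ s) :
    {i : Σ b : s, Fin (m b) | (i.1 : α) = a}.encard = m a := by
  have hfiber : {i : Σ b : s, Fin (m b) | (i.1 : α) = a} =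
      Set.range (Sigma.mk (β := fun b : s => Fin (m b)) ⟨a, ha⟩) := by
    ext ⟨⟨b, hb⟩, k⟩
    constructor
    · rintro rfl
      exact ⟨k, rfl⟩
    · rintro ⟨l, hl⟩
      exact congrArg (fun i => (i.1 : α)) hl.symm
  rw [hfiber, ← Set.image_univ, sigma_mk_injective.encard_image, Set.encard_univ,
    ENat.card_eq_coe_fintype_card, Fintype.card_fin]

end Enumeration

section EvenZeros

variable {f : ℂ → ℂ} {p : ℝ} {ι : Type*} {v : ι → ℂ}

theorem analyticOrderAt_ne_top_of_differentiable (hf : Differentiable ℂ f) {w : ℂ} (hw : f w ≠ 0)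
    (z : ℂ) : analyticOrderAt f z ≠ ⊤ := fun hz =>
  hw ((hf.differentiableOn.analyticOnNhd isOpen_univ).eqOn_zero_of_preconnected_of_eventuallyEq_zero
    isPreconnected_univ (Set.mem_univ z) (analyticOrderAt_eq_top.1 hz) (Set.mem_univ w))

theorem analyticOrderAt_neg_of_even (heven : Function.Even f) (z : ℂ) :
    analyticOrderAt f (-z) = analyticOrderAt f z := by
  have h := analyticOrderAt_comp_of_deriv_ne_zero (f := f) (g := fun z => -z) (z₀ := z)
    (by fun_prop) (by simp)
  rw [← h]
  exact congrArg (analyticOrderAt · z) (funext heven)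

theorem isZeroFamily_sumElim_neg (heven : Function.Even f) (h0 : ∀ z : ℂ, z.re = 0 → f z ≠ 0)
    (hpos : ∀ i, 0 < (v i).re)
    (hv : ∀ z : ℂ, 0 < z.re → {i | v i = z}.encard = analyticOrderAt f z) :
    IsZeroFamily f (Sum.elim v (-v)) := by
  intro w
  have hsplit : {i | Sum.elim v (-v) i = w} =
      Sum.inl '' {i | v i = w} ∪ Sum.inr '' {i | v i = -w} := by
    ext (i | i) <;> simp [neg_eq_iff_eq_neg]
  have hempty : ∀ z : ℂ, z.re ≤ 0 → {i | v i = z} = ∅ := fun z hz =>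
    Set.eq_empty_of_forall_notMem fun i hi => (hpos i).not_ge (hi ▸ hz)
  rw [hsplit]
  rcases lt_trichotomy w.re 0 with h | h | h
  · rw [hempty w h.le, Set.image_empty, Set.empty_union, Sum.inr_injective.encard_image,
      hv _ (by simpa using h), analyticOrderAt_neg_of_even heven]
  · rw [hempty w h.le, hempty (-w) (by simp [h]), Set.image_empty, Set.image_empty,
      Set.empty_union, Set.encard_empty, analyticOrderAt_eq_zero.2 (.inr (h0 w h))]
  · rw [hempty (-w) (by simpa using h.le), Set.image_empty, Set.union_empty,
      Sum.inl_injective.encard_image, hv w h]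

theorem infinite_of_not_norm_sq_le (hf : Differentiable ℂ f) (heven : Function.Even f)
    (h0 : ∀ z : ℂ, z.re = 0 → f z ≠ 0) (hp : 0 ≤ p) (hp2 : p < 2) (hgr : HasExpGrowth f p)
    (hpoly : ¬∃ K : ℝ, ∃ n : ℕ, ∀ z, ‖f z‖ ^ 2 ≤ K * (1 + ‖z‖) ^ n)
    (hpos : ∀ i, 0 < (v i).re)
    (hv : ∀ z : ℂ, 0 < z.re → {i | v i = z}.encard = analyticOrderAt f z) : Infinite ι := by
  by_contra hfin
  have := not_infinite_iff_finite.1 hfin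
  exact hpoly ((isZeroFamily_sumElim_neg heven h0 hpos hv).exists_norm_sq_le_of_finite hf
    (h0 0 Complex.zero_re) heven hp hp2 hgr)

theorem finite_re_le_of_abs_im_le (hf : Differentiable ℂ f) (heven : Function.Even f)
    (h0 : ∀ z : ℂ, z.re = 0 → f z ≠ 0) {b : ℝ} (him : ∀ z : ℂ, f z = 0 → |z.im| ≤ b)
    (hpos : ∀ i, 0 < (v i).re)
    (hv : ∀ z : ℂ, 0 < z.re → {i | v i = z}.encard = analyticOrderAt f z) (R : ℝ) :
    {i | (v i).re ≤ R}.Finite := by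
  have hfin := (isZeroFamily_sumElim_neg heven h0 hpos hv).finite_norm_le hf (h0 0 Complex.zero_re)
    (R + b)
  refine (hfin.preimage Sum.inl_injective.injOn).subset fun i (hi : (v i).re ≤ R) => ?_
  have hzero : f (v i) = 0 := by
    refine apply_eq_zero_of_analyticOrderAt_ne_zero ?_
    rw [← hv _ (hpos i), Set.encard_ne_zero]
    exact ⟨i, rfl⟩
  calc ‖v i‖ ≤ |(v i).re| + |(v i).im| := Complex.norm_le_abs_re_add_abs_im _
    _ ≤ R + b := add_le_add ((abs_of_pos (hpos i)).trans_le hi) (him _ hzero)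

theorem exists_seq_zeros_re_pos (hf : Differentiable ℂ f) (heven : Function.Even f)
    (h0 : ∀ z : ℂ, z.re = 0 → f z ≠ 0) (hp : 0 ≤ p) (hp2 : p < 2) (hgr : HasExpGrowth f p) {b : ℝ}
    (him : ∀ z : ℂ, f z = 0 → |z.im| ≤ b)
    (hpoly : ¬∃ K : ℝ, ∃ n : ℕ, ∀ z, ‖f z‖ ^ 2 ≤ K * (1 + ‖z‖) ^ n) :
    ∃ α : ℕ → ℂ, (∀ n, 0 < (α n).re) ∧ (Monotone fun n => (α n).re) ∧
      ∀ z : ℂ, 0 < z.re → {n | α n = z}.encard = analyticOrderAt f z := by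
  let v : (Σ z : {z : ℂ | 0 < z.re}, Fin (analyticOrderNatAt f z)) → ℂ := fun i => i.1
  have hpos : ∀ i, 0 < (v i).re := fun i => i.1.2
  have hv : ∀ z : ℂ, 0 < z.re → {i | v i = z}.encard = analyticOrderAt f z := fun z hz => by
    have hz_top := analyticOrderAt_ne_top_of_differentiable hf (h0 0 Complex.zero_re) z
    rw [← Nat.cast_analyticOrderNatAt hz_top]
    exact encard_sigma_fst_eq (s := {z : ℂ | 0 < z.re}) (analyticOrderNatAt f) hz
  have := infinite_of_not_norm_sq_le hf heven h0 hp hp2 hgr hpoly hpos hv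
  obtain ⟨e, he⟩ := exists_equiv_nat_monotone (fun i => (v i).re)
    (finite_re_le_of_abs_im_le hf heven h0 him hpos hv)
  refine ⟨fun n => v (e n), fun n => hpos (e n), he, fun z hz => ?_⟩
  have hfiber : {n | v (e n) = z} = e.symm '' {i | v i = z} := by
    rw [e.symm.image_eq_preimage_symm]
    rfl
  rw [hfiber, e.symm.injective.encard_image, hv z hz]

end EvenZeros

section MellinBounds

open MeasureTheory Set

theorem pow_div_factorial_le_exp_sub_one {x : ℝ} (hx : 0 ≤ x) {k : ℕ} (hk : k ≠ 0) :
    x ^ k / k.factorial ≤ Real.exp x - 1 := by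
  have hsum := Real.sum_le_exp_of_nonneg hx (k + 1)
  rw [Finset.sum_range_succ] at hsum
  have hone : 1 ≤ ∑ i ∈ Finset.range k, x ^ i / (i.factorial : ℝ) := by
    simpa using Finset.single_le_sum (f := fun i : ℕ => x ^ i / (i.factorial : ℝ))
      (fun i _ => by positivity) (Finset.mem_range.2 (Nat.pos_of_ne_zero hk))
  linarith

theorem norm_setIntegral_Ioi_cpow_smul_le {f : ℝ → ℂ} {s : ℂ} {a c : ℝ} (ha : s.re < a)
    (hf : ∀ x, 1 < x → ‖f x‖ ≤ c * x ^ (-a)) :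
    ‖∫ x in Ioi (1 : ℝ), (x : ℂ) ^ (s - 1) • f x‖ ≤ c / (a - s.re) := by
  have hexp : s.re - 1 - a < -1 := by linarith
  have hint : IntegrableOn (fun x : ℝ => c * x ^ (s.re - 1 - a)) (Ioi 1) :=
    (integrableOn_Ioi_rpow_of_lt hexp one_pos).const_mul c
  have hvalue : ∫ x in Ioi (1 : ℝ), c * x ^ (s.re - 1 - a) = c / (a - s.re) := by
    rw [integral_const_mul, integral_Ioi_rpow_of_lt hexp one_pos, Real.one_rpow]
    have : a - s.re ≠ 0 := by linarith
    have : s.re - 1 - a + 1 ≠ 0 := by linarith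
    field_simp
    ring
  rw [← hvalue]
  refine norm_integral_le_of_norm_le hint ((ae_restrict_iff' measurableSet_Ioi).2 (.of_forall ?_))
  intro x (hx : 1 < x)
  have hx0 : 0 < x := one_pos.trans hx
  rw [norm_smul, Complex.norm_cpow_eq_rpow_re_of_pos hx0, sub_eq_add_neg _ a, Real.rpow_add hx0,
    mul_left_comm]
  exact mul_le_mul_of_nonneg_left (hf x hx) (Real.rpow_nonneg hx0.le _)

theorem norm_setIntegral_Ioc_cpow_smul_le {f : ℝ → ℂ} {s : ℂ} {b c : ℝ} (hb : -b < s.re)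
    (hf : ∀ x, 0 < x → x ≤ 1 → ‖f x‖ ≤ c * x ^ b) :
    ‖∫ x in Ioc (0 : ℝ) 1, (x : ℂ) ^ (s - 1) • f x‖ ≤ c / (b + s.re) := by
  have hexp : -1 < s.re - 1 + b := by linarith
  have hint : IntegrableOn (fun x : ℝ => c * x ^ (s.re - 1 + b)) (Ioc 0 1) := by
    rw [← intervalIntegrable_iff_integrableOn_Ioc_of_le zero_le_one]
    exact (intervalIntegral.intervalIntegrable_rpow' hexp).const_mul c
  have hvalue : ∫ x in Ioc (0 : ℝ) 1, c * x ^ (s.re - 1 + b) = c / (b + s.re) := by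
    rw [integral_const_mul, ← intervalIntegral.integral_of_le zero_le_one,
      integral_rpow (.inl hexp), Real.one_rpow, Real.zero_rpow (by linarith), sub_zero,
      mul_one_div]
    congr 1
    ring
  rw [← hvalue]
  refine norm_integral_le_of_norm_le hint ((ae_restrict_iff' measurableSet_Ioc).2 (.of_forall ?_))
  rintro x ⟨hx0, hx1⟩
  rw [norm_smul, Complex.norm_cpow_eq_rpow_re_of_pos hx0, Real.rpow_add hx0, mul_left_comm]
  exact mul_le_mul_of_nonneg_left (hf x hx0 hx1) (Real.rpow_nonneg hx0.le _)

theorem norm_mellin_le {f : ℝ → ℂ} {s : ℂ} {a b c : ℝ} (hconv : MellinConvergent f s)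
    (ha : s.re < a) (hb : -b < s.re) (hf : ∀ x, 1 < x → ‖f x‖ ≤ c * x ^ (-a))
    (hf' : ∀ x, 0 < x → x ≤ 1 → ‖f x‖ ≤ c * x ^ b) :
    ‖mellin f s‖ ≤ c / (b + s.re) + c / (a - s.re) := by
  have hsplit : mellin f s = (∫ x in Ioc (0 : ℝ) 1, (x : ℂ) ^ (s - 1) • f x) +
      ∫ x in Ioi (1 : ℝ), (x : ℂ) ^ (s - 1) • f x := by
    rw [mellin, ← Ioc_union_Ioi_eq_Ioi zero_le_one]
    exact setIntegral_union (Ioc_disjoint_Ioi le_rfl) measurableSet_Ioi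
      (hconv.mono_set Ioc_subset_Ioi_self) (hconv.mono_set (Ioi_subset_Ioi zero_le_one))
  rw [hsplit]
  exact (norm_add_le _ _).trans (add_le_add (norm_setIntegral_Ioc_cpow_smul_le hb hf')
    (norm_setIntegral_Ioi_cpow_smul_le ha hf))

end MellinBounds

section CompletedZeta

open HurwitzZeta

theorem cosKernel_zero_sub_one_nonneg {x : ℝ} (hx : 0 < x) : 0 ≤ cosKernel 0 x - 1 := by
  refine (hasSum_nat_cosKernel₀ 0 hx).nonneg fun n => ?_
  simp only [mul_zero, zero_mul, Real.cos_zero, mul_one]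
  positivity

theorem cosKernel_zero_sub_one_le {x : ℝ} (hx : 0 < x) :
    cosKernel 0 x - 1 ≤ 2 / (Real.exp (Real.pi * x) - 1) := by
  have hkernel := hasSum_nat_cosKernel₀ 0 hx
  simp only [mul_zero, zero_mul, Real.cos_zero, mul_one] at hkernel
  have hu : 0 < Real.pi * x := by positivity
  set r := Real.exp (-(Real.pi * x)) with hr
  have hr1 : r < 1 := Real.exp_lt_one_iff.2 (neg_neg_of_pos hu)
  have hgeom : HasSum (fun n : ℕ => 2 * r * r ^ n) (2 * r * (1 - r)⁻¹) :=
    (hasSum_geometric_of_lt_one (Real.exp_pos _).le hr1).mul_left _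
  have hvalue : 2 * r * (1 - r)⁻¹ = 2 / (Real.exp (Real.pi * x) - 1) := by
    rw [← neg_neg (Real.pi * x), Real.exp_neg, ← hr]
    have : 1 - r ≠ 0 := (sub_pos.2 hr1).ne'
    have : 0 < r := Real.exp_pos _
    field_simp
  rw [← hvalue]
  refine hasSum_le (fun n => ?_) hkernel hgeom
  rw [mul_assoc 2 r, ← pow_succ', hr, ← Real.exp_nat_mul]
  refine mul_le_mul_of_nonneg_left (Real.exp_le_exp.2 ?_) two_pos.le
  have hsq : ((n : ℝ) + 1) ≤ ((n : ℝ) + 1) ^ 2 := by nlinarith [Nat.cast_nonneg (α := ℝ) n]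
  push_cast
  nlinarith

theorem cosKernel_zero_sub_one_le_div_pow {x : ℝ} (hx : 0 < x) {k : ℕ} (hk : k ≠ 0) :
    cosKernel 0 x - 1 ≤ 2 * k.factorial / (Real.pi * x) ^ k :=
  calc cosKernel 0 x - 1 ≤ 2 / (Real.exp (Real.pi * x) - 1) := cosKernel_zero_sub_one_le hx
    _ ≤ 2 / ((Real.pi * x) ^ k / k.factorial) := by
      gcongr
      exact pow_div_factorial_le_exp_sub_one (by positivity) hk
    _ = 2 * k.factorial / (Real.pi * x) ^ k := div_div_eq_mul_div _ _ _

theorem norm_f_modif_le_of_one_lt {x : ℝ} (hx : 1 < x) {k : ℕ} (hk : k ≠ 0) :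
    ‖(hurwitzEvenFEPair 0).f_modif x‖ ≤ 2 * k.factorial / Real.pi ^ k * x ^ (-(k : ℝ)) := by
  have h0 : 0 < x := one_pos.trans hx
  have hmodif : (hurwitzEvenFEPair 0).f_modif x = ((cosKernel 0 x - 1 : ℝ) : ℂ) := by
    simp [WeakFEPair.f_modif, hx, hx.le, hurwitzEvenFEPair, evenKernel_eq_cosKernel_of_zero]
  rw [hmodif, Complex.norm_of_nonneg (cosKernel_zero_sub_one_nonneg h0), Real.rpow_neg h0.le,
    Real.rpow_natCast, ← div_eq_mul_inv, div_div, ← mul_pow]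
  exact cosKernel_zero_sub_one_le_div_pow h0 hk

theorem norm_f_modif_le_of_le_one {x : ℝ} (h0 : 0 < x) (hx : x ≤ 1) {k : ℕ} (hk : k ≠ 0) :
    ‖(hurwitzEvenFEPair 0).f_modif x‖
      ≤ 2 * k.factorial / Real.pi ^ k * x ^ ((k : ℝ) - 1 / 2) := by
  rcases hx.eq_or_lt with rfl | hx
  · have hzero : (hurwitzEvenFEPair 0).f_modif 1 = 0 := by simp [WeakFEPair.f_modif]
    rw [hzero, norm_zero]
    positivity
  have hmodif : (hurwitzEvenFEPair 0).f_modif x =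
      ((1 / x ^ (1 / 2 : ℝ) * (cosKernel 0 (1 / x) - 1) : ℝ) : ℂ) := by
    simp [WeakFEPair.f_modif, hx, hx.le, h0, hurwitzEvenFEPair, evenKernel_functional_equation 0 x,
      Real.rpow_neg h0.le, mul_sub]
  have hnonneg := cosKernel_zero_sub_one_nonneg (one_div_pos.2 h0)
  rw [hmodif, Complex.norm_of_nonneg (by positivity)]
  calc 1 / x ^ (1 / 2 : ℝ) * (cosKernel 0 (1 / x) - 1)
      ≤ 1 / x ^ (1 / 2 : ℝ) * (2 * k.factorial / (Real.pi * (1 / x)) ^ k) := by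
        gcongr
        exact cosKernel_zero_sub_one_le_div_pow (one_div_pos.2 h0) hk
    _ = 2 * k.factorial / Real.pi ^ k * x ^ ((k : ℝ) - 1 / 2) := by
      rw [Real.rpow_sub h0, Real.rpow_natCast, mul_pow, div_pow, one_pow]
      field_simp

theorem norm_completedRiemannZeta₀_le {s : ℂ} {k : ℕ} (hk : k ≠ 0) (h0 : 0 ≤ s.re)
    (hs : s.re ≤ 2 * k - 2) :
    ‖completedRiemannZeta₀ s‖ ≤ 3 * (k.factorial / Real.pi ^ k) := by
  have hk1 : (1 : ℝ) ≤ k := Nat.one_le_cast.2 (Nat.one_le_iff_ne_zero.2 hk)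
  have hre : (s / 2).re = s.re / 2 := by simp
  have hconv : MellinConvergent (hurwitzEvenFEPair 0).f_modif (s / 2) :=
    ((hurwitzEvenFEPair 0).isStrongFEPair_toStrongFEPair.hasMellin _).1
  have hmellin := norm_mellin_le hconv (a := k) (b := k - 1 / 2) (by rw [hre]; linarith)
    (by rw [hre]; linarith) (fun x hx => norm_f_modif_le_of_one_lt hx hk)
    fun x hx hx' => norm_f_modif_le_of_le_one hx hx' hk
  have hzeta : completedRiemannZeta₀ s = mellin (hurwitzEvenFEPair 0).f_modif (s / 2) / 2 := rfl
  rw [hzeta, norm_div, Complex.norm_ofNat, div_le_iff₀ two_pos]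
  refine hmellin.trans ?_
  set c : ℝ := 2 * k.factorial / Real.pi ^ k with hc
  have hc0 : 0 ≤ c := by positivity
  calc c / (k - 1 / 2 + (s / 2).re) + c / (k - (s / 2).re) ≤ c / (1 / 2) + c / 1 := by
        gcongr <;> linarith
    _ = 3 * (k.factorial / Real.pi ^ k) * 2 := by rw [hc]; ring

theorem norm_completedRiemannZeta₀_lt_one {s : ℂ} (h0 : 0 ≤ s.re) (h1 : s.re ≤ 1) :
    ‖completedRiemannZeta₀ s‖ < 1 := by
  have hle := norm_completedRiemannZeta₀_le two_ne_zero h0 (by norm_num; linarith)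
  refine hle.trans_lt ?_
  rw [← mul_div_assoc, div_lt_one (by positivity)]
  norm_num [Nat.factorial]
  nlinarith [Real.pi_gt_three]

end CompletedZeta

section XiFunction

open Complex Filter Topology

theorem xi_one_sub (s : ℂ) : xi (1 - s) = xi s := by
  rw [xi, xi, completedRiemannZeta₀_one_sub]
  ring

theorem xi_eq_of_re_pos {s : ℂ} (hs : 0 < s.re) (h1 : s ≠ 1) :
    xi s = s * (s - 1) / 2 * (Real.pi : ℂ) ^ (-s / 2) * Gamma (s / 2) * riemannZeta s := by
  refine xi_eq s h1 fun n hn => hs.not_ge ?_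
  simp [hn]

theorem pi_cpow_ne_zero (s : ℂ) : (Real.pi : ℂ) ^ s ≠ 0 := by
  simp [cpow_eq_zero_iff, Real.pi_ne_zero]

theorem xi_ne_zero_of_one_le_re {s : ℂ} (hs : 1 ≤ s.re) : xi s ≠ 0 := by
  rcases eq_or_ne s 1 with rfl | h1
  · simp [xi]
  have hre : 0 < s.re := one_pos.trans_le hs
  have h0 : s ≠ 0 := by
    rintro rfl
    exact hre.ne' zero_re
  have hΓ : Gamma (s / 2) ≠ 0 := Gamma_ne_zero_of_re_pos (by simpa using hre)
  rw [xi_eq_of_re_pos hre h1]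
  exact mul_ne_zero (mul_ne_zero (mul_ne_zero (div_ne_zero (mul_ne_zero h0 (sub_ne_zero.2 h1))
    two_ne_zero) (pi_cpow_ne_zero _)) hΓ) (riemannZeta_ne_zero_of_one_le_re hs)

theorem xi_ofReal_ne_zero_of_mem_Icc {x : ℝ} (hx : x ∈ Set.Icc (0 : ℝ) 1) : xi x ≠ 0 := by
  intro h
  have hone : (x : ℂ) * (1 - x) * completedRiemannZeta₀ x = 1 := by
    rw [xi] at h
    linear_combination (-2) * h
  have hle : ‖(x : ℂ) * (1 - x)‖ ≤ 1 := by
    rw [← ofReal_one, ← ofReal_sub, ← ofReal_mul,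
      Complex.norm_of_nonneg (mul_nonneg hx.1 (sub_nonneg.2 hx.2))]
    nlinarith [sq_nonneg (x - 1 / 2)]
  have hlt : ‖(x : ℂ) * (1 - x) * completedRiemannZeta₀ x‖ < 1 := by
    rw [norm_mul]
    exact (mul_le_of_le_one_left (norm_nonneg _) hle).trans_lt
      (norm_completedRiemannZeta₀_lt_one (by simpa using hx.1) (by simpa using hx.2))
  rw [hone, norm_one] at hlt
  exact lt_irrefl _ hlt

theorem xi_ofReal_ne_zero (x : ℝ) : xi x ≠ 0 := by
  rcases le_or_gt 1 x with h1 | h1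
  · exact xi_ne_zero_of_one_le_re (by simpa using h1)
  rcases le_or_gt 0 x with h0 | h0
  · exact xi_ofReal_ne_zero_of_mem_Icc ⟨h0, h1.le⟩
  · rw [← xi_one_sub]
    exact xi_ne_zero_of_one_le_re (by simpa using h0.le)

theorem differentiable_Xi : Differentiable ℂ Xi := by
  have := differentiable_xi
  unfold Xi
  fun_prop

theorem even_Xi : Function.Even Xi := fun t => by
  rw [Xi, Xi, ← xi_one_sub]
  ring_nf

theorem Xi_ne_zero_of_re_eq_zero {t : ℂ} (ht : t.re = 0) : Xi t ≠ 0 := by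
  have hreal : 1 / 2 + I * t = ((1 / 2 - t.im : ℝ) : ℂ) := by
    apply Complex.ext <;> simp [ht, sub_eq_add_neg]
  rw [Xi, hreal]
  exact xi_ofReal_ne_zero _

theorem neg_one_half_lt_im_of_Xi_eq_zero {t : ℂ} (ht : Xi t = 0) : -(1 / 2) < t.im := by
  by_contra! him
  refine xi_ne_zero_of_one_le_re ?_ ht
  simp only [add_re, div_ofNat_re, one_re, I_mul_re]
  linarith

theorem abs_im_le_of_Xi_eq_zero {t : ℂ} (ht : Xi t = 0) : |t.im| ≤ 1 / 2 := by
  have hneg := neg_one_half_lt_im_of_Xi_eq_zero (t := -t) (by rw [even_Xi, ht])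
  rw [neg_im, neg_lt_neg_iff] at hneg
  exact abs_le.2 ⟨(neg_one_half_lt_im_of_Xi_eq_zero ht).le, hneg.le⟩

end XiFunction

section XiGrowth

open Complex

theorem norm_completedRiemannZeta₀_le_rpow {s : ℂ} (hs : 0 ≤ s.re) :
    ‖completedRiemannZeta₀ s‖ ≤ (‖s‖ + 2) ^ (‖s‖ + 2) := by
  set r := ‖s‖
  have hr : 0 ≤ r := norm_nonneg _
  set k : ℕ := ⌈r⌉₊ + 1 with hk
  have hkr : r + 1 ≤ k ∧ (k : ℝ) ≤ r + 2 := by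
    rw [hk, Nat.cast_add_one]
    constructor <;> linarith [Nat.le_ceil r, Nat.ceil_lt_add_one hr]
  have hpi : 3 ≤ Real.pi ^ k := Real.pi_gt_three.le.trans
    (le_self_pow₀ (by linarith [Real.pi_gt_three]) (Nat.succ_ne_zero _))
  calc ‖completedRiemannZeta₀ s‖ ≤ 3 * (k.factorial / Real.pi ^ k) :=
        norm_completedRiemannZeta₀_le (Nat.succ_ne_zero _) hs
          (by linarith [re_le_norm s, hkr.1])
    _ ≤ k.factorial := by
      rw [mul_div_left_comm]
      exact mul_le_of_le_one_right (Nat.cast_nonneg _) ((div_le_one (by positivity)).2 hpi)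
    _ ≤ (k : ℝ) ^ k := mod_cast Nat.factorial_le_pow k
    _ ≤ (r + 2) ^ k := by gcongr; exact hkr.2
    _ = (r + 2) ^ (k : ℝ) := (Real.rpow_natCast _ _).symm
    _ ≤ (r + 2) ^ (r + 2) := Real.rpow_le_rpow_of_exponent_le (by linarith) hkr.2

theorem norm_xi_le {s : ℂ} (hs : 0 ≤ s.re) : ‖xi s‖ ≤ (‖s‖ + 2) ^ (‖s‖ + 4) := by
  have hzeta := norm_completedRiemannZeta₀_le_rpow hs
  set r := ‖s‖
  have hr : 0 ≤ r := norm_nonneg _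
  set Q := (r + 2) ^ (r + 2)
  have hQ : 1 ≤ Q := Real.one_le_rpow (by linarith) (by linarith)
  have hsub : ‖s - 1‖ ≤ r + 1 := by simpa using norm_sub_le s 1
  calc ‖xi s‖ ≤ (‖s * (s - 1) * completedRiemannZeta₀ s‖ + ‖(1 : ℂ)‖) / 2 := by
        rw [xi, norm_div, norm_ofNat]
        gcongr
        exact norm_add_le _ _
    _ ≤ (r * (r + 1) * Q + 1) / 2 := by
      rw [norm_mul, norm_mul, norm_one]
      gcongr
    _ ≤ (r + 2) ^ 2 * Q := by nlinarith
    _ = (r + 2) ^ (r + 4) := by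
      rw [show r + 4 = 2 + (r + 2) by ring, Real.rpow_add (by linarith), Real.rpow_two]

theorem rpow_add_four_le_exp {r p : ℝ} (hr : 0 ≤ r) (hp : 1 < p) :
    (r + 2) ^ (r + 4) ≤ Real.exp ((r + 4) ^ p / (p - 1)) := by
  have hp' : 0 < p - 1 := sub_pos.2 hp
  rw [Real.rpow_def_of_pos (by linarith), Real.exp_le_exp]
  calc Real.log (r + 2) * (r + 4) ≤ Real.log (r + 4) * (r + 4) := by gcongr; norm_num
    _ ≤ (r + 4) ^ (p - 1) / (p - 1) * (r + 4) := by
      gcongr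
      exact Real.log_le_rpow_div (by linarith) hp'
    _ = (r + 4) ^ p / (p - 1) := by
      rw [Real.rpow_sub_one (by linarith)]
      field_simp

theorem hasExpGrowth_Xi {p : ℝ} (hp : 1 < p) : HasExpGrowth Xi p := by
  have hp' : 0 < p - 1 := sub_pos.2 hp
  refine ⟨5 ^ p / (p - 1), by positivity, fun t => ?_⟩
  wlog h : 0 ≤ (1 / 2 + I * t).re generalizing t
  · have hneg := this (-t) (by
      simp only [add_re, div_ofNat_re, one_re, I_mul_re, neg_im] at h ⊢
      linarith)
    rwa [even_Xi, norm_neg] at hneg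
  have hnorm : ‖1 / 2 + I * t‖ + 4 ≤ 5 * (1 + ‖t‖) := by
    have hle := norm_add_le (1 / 2 : ℂ) (I * t)
    rw [norm_mul, norm_I, one_mul, norm_div, norm_one, norm_ofNat] at hle
    linarith [norm_nonneg t]
  calc ‖Xi t‖ ≤ Real.exp ((‖1 / 2 + I * t‖ + 4) ^ p / (p - 1)) :=
        (norm_xi_le h).trans (rpow_add_four_le_exp (norm_nonneg _) hp)
    _ ≤ Real.exp ((5 * (1 + ‖t‖)) ^ p / (p - 1)) := by gcongr
    _ = Real.exp (5 ^ p / (p - 1) * (1 + ‖t‖) ^ p) := by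
      rw [Real.mul_rpow (by norm_num) (by positivity), div_mul_eq_mul_div]

theorem one_le_norm_riemannZeta_natCast {k : ℕ} (hk : 1 < k) : 1 ≤ ‖riemannZeta k‖ := by
  have hreal : riemannZeta k = ((∑' n : ℕ, 1 / (n : ℝ) ^ k : ℝ) : ℂ) := by
    rw [zeta_nat_eq_tsum_of_gt_one hk]
    push_cast
    rfl
  have hle := (Real.summable_one_div_nat_pow.2 hk).le_tsum 1 fun n _ => by positivity
  rw [Nat.cast_one, one_pow, div_one] at hle
  rw [hreal, Complex.norm_of_nonneg (one_pos.le.trans hle)]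
  exact hle

theorem xi_two_mul_natCast {n : ℕ} (hn : n ≠ 0) :
    xi (2 * n) = (2 * n - 1) * (n.factorial / Real.pi ^ n) * riemannZeta (2 * n) := by
  have hn' : (0 : ℝ) < n := Nat.cast_pos.2 (Nat.pos_of_ne_zero hn)
  have hre : 0 < (2 * (n : ℂ)).re := by simpa using hn'
  have hne : 2 * (n : ℂ) ≠ 1 := mod_cast (by omega : 2 * n ≠ 1)
  have hfactorial : (n.factorial : ℂ) = n * Gamma n := by
    rw [← Gamma_nat_eq_factorial, Gamma_add_one _ (Nat.cast_ne_zero.2 hn)]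
  rw [xi_eq_of_re_pos hre hne, neg_div, mul_div_cancel_left₀ _ two_ne_zero, cpow_neg, cpow_natCast,
    hfactorial]
  ring

theorem factorial_div_pow_le_norm_xi {n : ℕ} (hn : n ≠ 0) :
    (n.factorial : ℝ) / Real.pi ^ n ≤ ‖xi (2 * n)‖ := by
  have hn' : (1 : ℝ) ≤ n := Nat.one_le_cast.2 (Nat.one_le_iff_ne_zero.2 hn)
  have hzeta : 1 ≤ ‖riemannZeta (2 * n)‖ := by
    exact_mod_cast one_le_norm_riemannZeta_natCast (k := 2 * n) (by omega)
  have hreal : (2 * n - 1 : ℂ) * (n.factorial / Real.pi ^ n) =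
      ((2 * n - 1) * (n.factorial / Real.pi ^ n) : ℝ) := by push_cast; rfl
  have hpos : 0 ≤ (n.factorial : ℝ) / Real.pi ^ n := by positivity
  rw [xi_two_mul_natCast hn, hreal, norm_mul,
    Complex.norm_of_nonneg (mul_nonneg (by linarith) hpos)]
  calc (n.factorial : ℝ) / Real.pi ^ n ≤ (2 * n - 1) * (n.factorial / Real.pi ^ n) :=
        le_mul_of_one_le_left hpos (by linarith)
    _ ≤ (2 * n - 1) * (n.factorial / Real.pi ^ n) * ‖riemannZeta (2 * n)‖ :=
      le_mul_of_one_le_right (mul_nonneg (by linarith) hpos) hzeta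

theorem exists_mul_pow_lt_factorial_div_pow (K : ℝ) (m : ℕ) {a : ℝ} (ha : 0 < a) :
    ∃ n : ℕ, n ≠ 0 ∧ K * (n : ℝ) ^ m < n.factorial / a ^ n := by
  have hlim : Filter.Tendsto (fun n : ℕ => K * ((n : ℝ) ^ m / 2 ^ n * ((2 * a) ^ n / n.factorial)))
      Filter.atTop (nhds (K * (0 * 0))) :=
    ((tendsto_pow_const_div_const_pow_of_one_lt m one_lt_two).mul
      (FloorSemiring.tendsto_pow_div_factorial_atTop (2 * a))).const_mul K
  rw [mul_zero, mul_zero] at hlim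
  obtain ⟨n, hn0, hn⟩ :=
    ((Filter.eventually_ne_atTop 0).and (hlim.eventually_lt_const one_pos)).exists
  refine ⟨n, hn0, ?_⟩
  rw [lt_div_iff₀ (by positivity)]
  calc K * (n : ℝ) ^ m * a ^ n
      = K * ((n : ℝ) ^ m / 2 ^ n * ((2 * a) ^ n / n.factorial)) * n.factorial := by
        rw [mul_pow]
        field_simp
    _ < n.factorial := (mul_lt_iff_lt_one_left (by positivity)).2 hn

theorem not_norm_Xi_sq_le_pow : ¬∃ K : ℝ, ∃ m : ℕ, ∀ z, ‖Xi z‖ ^ 2 ≤ K * (1 + ‖z‖) ^ m := by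
  rintro ⟨K, m, hK⟩
  have hK0 : 0 ≤ K := (sq_nonneg ‖Xi 0‖).trans (by simpa using hK 0)
  obtain ⟨n, hn, hlt⟩ := exists_mul_pow_lt_factorial_div_pow (K * 3 ^ m) m (a := Real.pi ^ 2)
    (by positivity)
  have hn' : (1 : ℝ) ≤ n := Nat.one_le_cast.2 (Nat.one_le_iff_ne_zero.2 hn)
  set z : ℂ := -(I * (2 * n - 1 / 2 : ℝ)) with hz
  have hxi : Xi z = xi (2 * n) := by
    rw [Xi, hz]
    congr 1
    push_cast
    linear_combination -(2 * (n : ℂ) - 1 / 2) * I_sq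
  have hnorm : 1 + ‖z‖ ≤ 3 * n := by
    rw [hz, norm_neg, norm_mul, norm_I, one_mul, Complex.norm_of_nonneg (by linarith)]
    linarith
  refine hlt.not_ge ?_
  calc (n.factorial : ℝ) / (Real.pi ^ 2) ^ n ≤ (n.factorial : ℝ) ^ 2 / (Real.pi ^ 2) ^ n := by
        gcongr
        exact le_self_pow₀ (mod_cast n.factorial_pos) two_ne_zero
    _ = (n.factorial / Real.pi ^ n) ^ 2 := by rw [div_pow, ← pow_mul, ← pow_mul, mul_comm]
    _ ≤ ‖Xi z‖ ^ 2 := by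
      rw [hxi]
      gcongr
      exact factorial_div_pow_le_norm_xi hn
    _ ≤ K * (1 + ‖z‖) ^ m := hK z
    _ ≤ K * (3 * n) ^ m := by gcongr
    _ = K * 3 ^ m * n ^ m := by ring

theorem exists_isXiZeroSequence : ∃ α : ℕ → ℂ, IsXiZeroSequence α := by
  obtain ⟨α, hpos, hmono, hmult⟩ := exists_seq_zeros_re_pos differentiable_Xi even_Xi
    (fun _ => Xi_ne_zero_of_re_eq_zero) (p := 3 / 2) (by norm_num) (by norm_num)
    (hasExpGrowth_Xi (by norm_num)) (fun _ => abs_im_le_of_Xi_eq_zero) not_norm_Xi_sq_le_pow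
  exact ⟨α, hpos, hmono, hmult⟩

end XiGrowth

section Digamma

open Complex Filter Topology

theorem deriv_eq_ofReal_deriv {f : ℂ → ℂ} {g : ℝ → ℝ} {x : ℝ} (hf : DifferentiableAt ℂ f x)
    (hfg : ∀ᶠ y : ℝ in 𝓝 x, f y = g y) : deriv f x = (deriv g x : ℝ) := by
  have hg : HasDerivAt g (deriv f x).re x := by
    refine hf.hasDerivAt.real_of_complex.congr_of_eventuallyEq ?_
    filter_upwards [hfg] with y hy
    rw [hy, ofReal_re]
  have hcoe : HasDerivAt (fun y : ℝ => f y) ((deriv f x).re : ℂ) x :=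
    hg.ofReal_comp.congr_of_eventuallyEq hfg
  rw [hg.deriv]
  exact hf.hasDerivAt.comp_ofReal.unique hcoe

theorem ne_neg_natCast_of_re_pos {s : ℂ} (hs : 0 < s.re) (m : ℕ) : s ≠ -m := by
  rintro rfl
  simp [(Nat.cast_nonneg m).not_gt] at hs

theorem analyticAt_Gamma {s : ℂ} (hs : ∀ m : ℕ, s ≠ -m) : AnalyticAt ℂ Gamma s := by
  have hinv := (differentiable_one_div_Gamma.analyticAt s).inv (inv_ne_zero (Gamma_ne_zero hs))
  exact hinv.congr (.of_forall fun z => inv_inv _)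

theorem analyticAt_digamma {s : ℂ} (hs : ∀ m : ℕ, s ≠ -m) : AnalyticAt ℂ digamma s :=
  analyticAt_logDeriv (analyticAt_Gamma hs) (Gamma_ne_zero hs)

theorem digamma_ofReal {x : ℝ} (hx : ∀ m : ℕ, x ≠ -m) :
    digamma x = (logDeriv Real.Gamma x : ℝ) := by
  have hx' : ∀ m : ℕ, (x : ℂ) ≠ -m := fun m => mod_cast hx m
  rw [digamma_def, logDeriv_apply, logDeriv_apply, Gamma_ofReal, ofReal_div,
    deriv_eq_ofReal_deriv (differentiableAt_Gamma x hx') (.of_forall Gamma_ofReal)]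

theorem differentiableAt_Gamma_of_pos {x : ℝ} (hx : 0 < x) : DifferentiableAt ℝ Real.Gamma x :=
  Real.differentiableAt_Gamma fun m => by linarith [Nat.cast_nonneg (α := ℝ) m]

theorem monotoneOn_logDeriv_Gamma : MonotoneOn (logDeriv Real.Gamma) (Set.Ioi 0) := by
  have hlog : ∀ x ∈ Set.Ioi (0 : ℝ), deriv (Real.log ∘ Real.Gamma) x = logDeriv Real.Gamma x :=
    fun x hx => deriv.log (differentiableAt_Gamma_of_pos hx) (Real.Gamma_pos_of_pos hx).ne'
  exact (Real.convexOn_log_Gamma.monotoneOn_deriv fun x hx =>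
    (differentiableAt_Gamma_of_pos hx).log (Real.Gamma_pos_of_pos hx).ne').congr hlog

theorem logDeriv_Gamma_add_one {x : ℝ} (hx : 0 < x) :
    logDeriv Real.Gamma (x + 1) = logDeriv Real.Gamma x + 1 / x := by
  have hne : ∀ {y : ℝ}, 0 < y → ∀ m : ℕ, y ≠ -m := fun hy m => by
    linarith [Nat.cast_nonneg (α := ℝ) m]
  have h := digamma_apply_add_one x (ne_neg_natCast_of_re_pos (by simpa using hx))
  rw [← ofReal_one, ← ofReal_add, digamma_ofReal (hne hx), digamma_ofReal (hne (by linarith))] at h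
  rw [one_div]
  exact_mod_cast h

theorem logDeriv_Gamma_add_natCast {x : ℝ} (hx : 0 < x) (N : ℕ) :
    logDeriv Real.Gamma (N + x) = logDeriv Real.Gamma x + ∑ n ∈ Finset.range N, 1 / (n + x) := by
  induction N with
  | zero => simp
  | succ N ih =>
    rw [Finset.sum_range_succ, ← add_assoc, ← ih, ← logDeriv_Gamma_add_one (by positivity),
      Nat.cast_add_one, add_right_comm]

theorem hasSum_logDeriv_Gamma_sub {x y : ℝ} (hy : 0 < y) (hyx : y ≤ x) (hxy : x ≤ y + 1) :
    HasSum (fun n : ℕ => 1 / (n + y) - 1 / (n + x)) (logDeriv Real.Gamma x - logDeriv Real.Gamma y)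
    := by
  have hx : 0 < x := hy.trans_le hyx
  have hterm : ∀ n : ℕ, 0 ≤ 1 / (n + y) - 1 / (n + x) := fun n =>
    sub_nonneg.2 (by gcongr)
  rw [hasSum_iff_tendsto_nat_of_nonneg hterm]
  -- The remainder `ψ(N + x) - ψ(N + y)` is at most `ψ(N + y + 1) - ψ(N + y) = 1 / (N + y)`.
  have hrem : Tendsto (fun N : ℕ => logDeriv Real.Gamma (N + x) - logDeriv Real.Gamma (N + y))
      atTop (𝓝 0) := by
    have hlim : Tendsto (fun N : ℕ => 1 / (N + y)) atTop (𝓝 0) := by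
      simp only [one_div]
      exact (tendsto_natCast_atTop_atTop.atTop_add tendsto_const_nhds).inv_tendsto_atTop
    refine squeeze_zero (fun N => ?_) (fun N => ?_) hlim
    · exact sub_nonneg.2 (monotoneOn_logDeriv_Gamma (Set.mem_Ioi.2 (by positivity))
        (Set.mem_Ioi.2 (by positivity)) (by gcongr))
    · rw [sub_le_iff_le_add', ← logDeriv_Gamma_add_one (by positivity)]
      exact monotoneOn_logDeriv_Gamma (Set.mem_Ioi.2 (by positivity))
        (Set.mem_Ioi.2 (by positivity)) (by linarith)
  have hpartial := hrem.const_sub (logDeriv Real.Gamma x - logDeriv Real.Gamma y)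
  rw [sub_zero] at hpartial
  refine hpartial.congr fun N => ?_
  rw [logDeriv_Gamma_add_natCast hx, logDeriv_Gamma_add_natCast hy, Finset.sum_sub_distrib]
  ring

theorem summable_one_div_natCast_add_sq (x : ℝ) :
    Summable fun n : ℕ => 1 / ((n : ℝ) + x) ^ 2 := by
  have h := (Real.summable_one_div_nat_add_rpow x 2).2 one_lt_two
  simpa using h

theorem deriv_logDeriv_Gamma {x : ℝ} (hx : 0 < x) :
    deriv (logDeriv Real.Gamma) x = ∑' n : ℕ, 1 / ((n : ℝ) + x) ^ 2 := by
  obtain ⟨y, hy, hyx⟩ := exists_between (max_lt hx (sub_one_lt x))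
  obtain ⟨hy0, hxy⟩ := max_lt_iff.1 hy
  have hx_mem : x ∈ Set.Ioo y (y + 1) := ⟨hyx, by linarith⟩
  have hpos : ∀ (n : ℕ) {z : ℝ}, z ∈ Set.Ioo y (y + 1) → 0 < n + z := fun n z hz =>
    add_pos_of_nonneg_of_pos n.cast_nonneg (hy0.trans hz.1)
  have hterm : ∀ (n : ℕ) (z : ℝ), z ∈ Set.Ioo y (y + 1) →
      HasDerivAt (fun z => 1 / (n + y) - 1 / (n + z)) (1 / (n + z) ^ 2) z := fun n z hz => by
    convert! (((hasDerivAt_id z).const_add (n : ℝ)).inv (hpos n hz).ne').const_sub (1 / (n + y))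
      using 1
    · simp only [one_div, id]
      rfl
    · simp [neg_div]
  have hderiv := hasDerivAt_tsum_of_isPreconnected (summable_one_div_natCast_add_sq y)
    isOpen_Ioo isPreconnected_Ioo hterm (fun n z hz => by
      have := hpos n hz
      rw [Real.norm_of_nonneg (by positivity)]
      gcongr
      exact hz.1.le) hx_mem (hasSum_logDeriv_Gamma_sub hy0 hyx.le hx_mem.2.le).summable hx_mem
  have hsum : (fun z => logDeriv Real.Gamma y + ∑' n : ℕ, (1 / (n + y) - 1 / (n + z))) =ᶠ[𝓝 x]
      logDeriv Real.Gamma := by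
    filter_upwards [isOpen_Ioo.mem_nhds hx_mem] with z hz
    rw [(hasSum_logDeriv_Gamma_sub hy0 hz.1.le hz.2.le).tsum_eq, add_sub_cancel]
  rw [← hsum.deriv_eq]
  exact (hderiv.const_add _).deriv

theorem deriv_digamma_ofReal {x : ℝ} (hx : 0 < x) :
    deriv digamma x = (∑' n : ℕ, 1 / ((n : ℝ) + x) ^ 2 : ℝ) := by
  have hx' : ∀ m : ℕ, (x : ℂ) ≠ -m := ne_neg_natCast_of_re_pos (by simpa using hx)
  rw [← deriv_logDeriv_Gamma hx]
  refine deriv_eq_ofReal_deriv (analyticAt_digamma hx').differentiableAt ?_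
  filter_upwards [lt_mem_nhds hx] with y hy
  exact digamma_ofReal fun m => by linarith [Nat.cast_nonneg (α := ℝ) m]

theorem logDeriv_Gamma_comp {g : ℂ → ℂ} {g' s : ℂ} (hg : HasDerivAt g g' s)
    (hs : ∀ m : ℕ, g s ≠ -m) : logDeriv (fun z => Gamma (g z)) s = digamma (g s) * g' := by
  rw [digamma_def, ← hg.deriv]
  exact logDeriv_comp (differentiableAt_Gamma _ hs) hg.differentiableAt

theorem digamma_one_sub_sub_digamma {s : ℂ} (hs : ∀ n : ℤ, s ≠ n) :
    digamma (1 - s) - digamma s = Real.pi * cot (Real.pi * s) := by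
  have h0 : ∀ m : ℕ, s ≠ -m := fun m => by simpa using hs (-m)
  have h1 : ∀ m : ℕ, 1 - s ≠ -m := fun m h => hs (1 + m) (by
    push_cast
    linear_combination -h)
  have hsin : sin (Real.pi * s) ≠ 0 := fun h => by
    have := Gamma_mul_Gamma_one_sub s
    rw [h, div_zero] at this
    exact mul_ne_zero (Gamma_ne_zero h0) (Gamma_ne_zero h1) this
  have hsub : HasDerivAt (fun z : ℂ => 1 - z) (-1) s := (hasDerivAt_id s).const_sub 1
  have hmul : HasDerivAt (fun z : ℂ => Real.pi * z) Real.pi s := by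
    simpa using (hasDerivAt_id s).const_mul (Real.pi : ℂ)
  have hleft := logDeriv_mul (f := Gamma) (g := fun z => Gamma (1 - z)) s (Gamma_ne_zero h0)
    (Gamma_ne_zero h1) (differentiableAt_Gamma s h0)
    ((differentiableAt_Gamma _ h1).comp s hsub.differentiableAt)
  have hright := logDeriv_div (f := fun _ => (Real.pi : ℂ)) (g := fun z => sin (Real.pi * z)) s
    (ofReal_ne_zero.2 Real.pi_ne_zero) hsin (by fun_prop) (by fun_prop)
  have hsin_comp : logDeriv (fun z => sin (Real.pi * z)) s = cot (Real.pi * s) * Real.pi := by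
    have h := logDeriv_comp (f := sin) (g := fun z => Real.pi * z) differentiableAt_sin
      hmul.differentiableAt
    rwa [hmul.deriv, logDeriv_sin] at h
  rw [← funext Gamma_mul_Gamma_one_sub, hleft, logDeriv_const, hsin_comp,
    logDeriv_Gamma_comp hsub h1, ← digamma_def, Pi.zero_apply] at hright
  linear_combination -hright

theorem digamma_add_digamma_add_half {s : ℂ} (hs : ∀ m : ℕ, 2 * s ≠ -m) :
    digamma s + digamma (s + 1 / 2) = 2 * digamma (2 * s) - 2 * Real.log 2 := by
  have h0 : ∀ m : ℕ, s ≠ -m := fun m h => hs (2 * m) (by rw [h]; push_cast; ring)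
  have h1 : ∀ m : ℕ, s + 1 / 2 ≠ -m := fun m h => hs (2 * m + 1) (by
    push_cast
    linear_combination 2 * h)
  have hadd : HasDerivAt (fun z : ℂ => z + 1 / 2) 1 s := (hasDerivAt_id s).add_const _
  have hmul : HasDerivAt (fun z : ℂ => 2 * z) 2 s := by
    simpa using (hasDerivAt_id s).const_mul (2 : ℂ)
  have hpow : HasDerivAt (fun z : ℂ => (2 : ℂ) ^ (1 - 2 * z))
      ((2 : ℂ) ^ (1 - 2 * s) * log 2 * (-2)) s := (hmul.const_sub 1).const_cpow (.inl two_ne_zero)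
  have hpow_ne : (2 : ℂ) ^ (1 - 2 * s) ≠ 0 := by simp [cpow_eq_zero_iff]
  have hsqrt : (√Real.pi : ℂ) ≠ 0 := ofReal_ne_zero.2 (Real.sqrt_pos.2 Real.pi_pos).ne'
  have hleft := logDeriv_mul (f := Gamma) (g := fun z => Gamma (z + 1 / 2)) s (Gamma_ne_zero h0)
    (Gamma_ne_zero h1) (differentiableAt_Gamma s h0)
    ((differentiableAt_Gamma _ h1).comp s hadd.differentiableAt)
  have hright := logDeriv_mul (f := fun z => Gamma (2 * z)) (g := fun z => 2 ^ (1 - 2 * z)) s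
    (Gamma_ne_zero hs) hpow_ne ((differentiableAt_Gamma _ hs).comp s hmul.differentiableAt)
    hpow.differentiableAt
  have hlogpow : logDeriv (fun z : ℂ => (2 : ℂ) ^ (1 - 2 * z)) s = -2 * Real.log 2 := by
    rw [logDeriv_apply, hpow.deriv, ofReal_log two_pos.le, ofReal_ofNat]
    field_simp
  rw [logDeriv_Gamma_comp hmul hs, hlogpow] at hright
  rw [logDeriv_Gamma_comp hadd h1, ← digamma_def, funext Gamma_mul_Gamma_add_half,
    logDeriv_mul_const _ _ hsqrt, hright] at hleft
  linear_combination -hleft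

theorem cot_pi_div_four : cot (Real.pi * (1 / 4)) = 1 := by
  have hangle : (Real.pi * (1 / 4) : ℂ) = (Real.pi / 4 : ℝ) := by push_cast; ring
  rw [cot_eq_cos_div_sin, hangle, ← ofReal_cos, ← ofReal_sin, Real.cos_pi_div_four,
    Real.sin_pi_div_four, div_self (ofReal_ne_zero.2 (by positivity))]

theorem digamma_one_fourth : digamma (1 / 4)
    = ((-Real.eulerMascheroniConstant - Real.pi / 2 - 3 * Real.log 2 : ℝ) : ℂ) := by
  have hne : ∀ n : ℤ, (1 / 4 : ℂ) ≠ n := fun n h => by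
    have h4 : (1 : ℤ) = 4 * n := by exact_mod_cast (by linear_combination 4 * h : (1 : ℂ) = 4 * n)
    omega
  have hreflection := digamma_one_sub_sub_digamma hne
  have hduplication := digamma_add_digamma_add_half (s := 1 / 4)
    (ne_neg_natCast_of_re_pos (by norm_num))
  rw [cot_pi_div_four, show (1 : ℂ) - 1 / 4 = 3 / 4 by norm_num] at hreflection
  rw [show (1 : ℂ) / 4 + 1 / 2 = 3 / 4 by norm_num, show (2 : ℂ) * (1 / 4) = 1 / 2 by norm_num,
    digamma_one_half] at hduplication
  push_cast [ofReal_log zero_le_two] at hduplication ⊢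
  linear_combination (hduplication - hreflection) / 2

theorem hasSum_one_div_odd_sq :
    HasSum (fun n : ℕ => 1 / (2 * (n : ℝ) + 1) ^ 2) (Real.pi ^ 2 / 8) := by
  have hodd : Summable fun n : ℕ => 1 / (2 * (n : ℝ) + 1) ^ 2 := by
    have hinj : Function.Injective fun n : ℕ => 2 * n + 1 := fun m n h => by
      dsimp only at h
      omega
    refine (hasSum_zeta_two.summable.comp_injective hinj).congr fun n => ?_
    rw [Function.comp_apply]
    push_cast
    rfl
  have heven : HasSum (fun n : ℕ => 1 / ((2 * n : ℕ) : ℝ) ^ 2) (Real.pi ^ 2 / 6 / 4) := by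
    convert! hasSum_zeta_two.div_const 4 using 2 with n
    push_cast
    rw [mul_pow, div_div]
    norm_num [mul_comm]
  have htotal := (heven.even_add_odd (f := fun n : ℕ => 1 / (n : ℝ) ^ 2)
    (by exact_mod_cast hodd.hasSum)).unique hasSum_zeta_two
  push_cast at htotal
  rw [hodd.hasSum_iff]
  linarith

theorem hasSum_catalanConstant :
    HasSum (fun n : ℕ => (-1 : ℝ) ^ n / (2 * (n : ℝ) + 1) ^ 2) catalanConstant := by
  refine Summable.hasSum (.of_norm ?_)
  simpa using hasSum_one_div_odd_sq.summable

theorem tsum_one_div_natCast_add_one_fourth_sq :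
    ∑' n : ℕ, 1 / ((n : ℝ) + 1 / 4) ^ 2 = Real.pi ^ 2 + 8 * catalanConstant := by
  -- Adding `∑ (-1)ⁿ / (2n+1)²` to `∑ 1 / (2n+1)²` doubles the even terms and cancels the odd ones.
  have hadd := hasSum_one_div_odd_sq.add hasSum_catalanConstant
  have heven : HasSum (fun k : ℕ => 1 / 8 * (1 / ((k : ℝ) + 1 / 4) ^ 2))
      (Real.pi ^ 2 / 8 + catalanConstant) := by
    rw [← (mul_right_injective₀ (two_ne_zero (α := ℕ))).hasSum_iff] at hadd
    · convert! hadd using 2 with k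
      rw [Function.comp_apply, pow_mul, neg_one_sq, one_pow, ← add_div]
      push_cast
      field_simp
      ring
    · intro n hn
      have hodd : Odd n := Nat.not_even_iff_odd.1 fun ⟨k, hk⟩ => hn ⟨k, by dsimp only; omega⟩
      rw [hodd.neg_one_pow, ← add_div, add_neg_cancel, zero_div]
  have hsum := heven.tsum_eq
  rw [tsum_mul_left] at hsum
  linarith

end Digamma

section LogDerivXi

open Complex Filter Topology

variable {s : ℂ}

theorem logDeriv_mul_sub_one_div_two (h0 : s ≠ 0) (h1 : s ≠ 1) :
    logDeriv (fun z : ℂ => z * (z - 1) / 2) s = 1 / s + 1 / (s - 1) := by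
  have h1' : s - 1 ≠ 0 := sub_ne_zero.2 h1
  have hderiv : HasDerivAt (fun z : ℂ => z * (z - 1) / 2) ((s - 1 + s) / 2) s := by
    simpa using ((hasDerivAt_id' s).fun_mul ((hasDerivAt_id' s).sub_const 1)).div_const 2
  rw [logDeriv_apply, hderiv.deriv]
  field_simp

theorem hasDerivAt_pi_cpow_neg_div_two (s : ℂ) :
    HasDerivAt (fun z : ℂ => (Real.pi : ℂ) ^ (-z / 2))
      ((Real.pi : ℂ) ^ (-s / 2) * log Real.pi * (-1 / 2)) s :=
  ((hasDerivAt_id s).neg.div_const 2).const_cpow (.inl (ofReal_ne_zero.2 Real.pi_ne_zero))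

theorem logDeriv_pi_cpow_neg_div_two (s : ℂ) :
    logDeriv (fun z : ℂ => (Real.pi : ℂ) ^ (-z / 2)) s = -(Real.log Real.pi / 2) := by
  have hne := pi_cpow_ne_zero (-s / 2)
  rw [logDeriv_apply, (hasDerivAt_pi_cpow_neg_div_two s).deriv, ofReal_log Real.pi_pos.le]
  field_simp

theorem logDeriv_xi (hs : 0 < s.re) (h1 : s ≠ 1) (hζ : riemannZeta s ≠ 0) :
    logDeriv xi s = 1 / s + 1 / (s - 1) - Real.log Real.pi / 2 + digamma (s / 2) / 2
      + logDeriv riemannZeta s := by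
  have h0 : s ≠ 0 := by
    rintro rfl
    exact hs.ne' zero_re
  have heq : xi =ᶠ[𝓝 s] fun z =>
      z * (z - 1) / 2 * (Real.pi : ℂ) ^ (-z / 2) * Gamma (z / 2) * riemannZeta z := by
    filter_upwards [(isOpen_lt continuous_const continuous_re).mem_nhds hs,
      eventually_ne_nhds h1] with z hz hz1
    exact xi_eq_of_re_pos hz hz1
  have hhalf : HasDerivAt (fun z : ℂ => z / 2) (1 / 2) s := (hasDerivAt_id s).div_const 2
  have hpole : ∀ m : ℕ, s / 2 ≠ -m := ne_neg_natCast_of_re_pos (by simpa using hs)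
  have hpoly_ne : s * (s - 1) / 2 ≠ 0 :=
    div_ne_zero (mul_ne_zero h0 (sub_ne_zero.2 h1)) two_ne_zero
  have hpoly_pi_ne := mul_ne_zero hpoly_ne (pi_cpow_ne_zero (-s / 2))
  have hΓ_ne : Gamma (s / 2) ≠ 0 := Gamma_ne_zero hpole
  have hpoly : DifferentiableAt ℂ (fun z : ℂ => z * (z - 1) / 2) s := by fun_prop
  have hpi := (hasDerivAt_pi_cpow_neg_div_two s).differentiableAt
  have hΓ : DifferentiableAt ℂ (fun z => Gamma (z / 2)) s :=
    (differentiableAt_Gamma _ hpole).comp s hhalf.differentiableAt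
  have hsplit_zeta := logDeriv_mul (g := riemannZeta)
    (f := fun z => z * (z - 1) / 2 * (Real.pi : ℂ) ^ (-z / 2) * Gamma (z / 2)) s
    (mul_ne_zero hpoly_pi_ne hΓ_ne) hζ ((hpoly.fun_mul hpi).fun_mul hΓ)
    (differentiableAt_riemannZeta h1)
  have hsplit_Gamma := logDeriv_mul (f := fun z => z * (z - 1) / 2 * (Real.pi : ℂ) ^ (-z / 2))
    (g := fun z => Gamma (z / 2)) s hpoly_pi_ne hΓ_ne (hpoly.fun_mul hpi) hΓ
  have hsplit_pi := logDeriv_mul (f := fun z => z * (z - 1) / 2)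
    (g := fun z => (Real.pi : ℂ) ^ (-z / 2)) s hpoly_ne (pi_cpow_ne_zero _) hpoly hpi
  rw [(logDeriv_congr_nhds heq).eq_of_nhds, hsplit_zeta, hsplit_Gamma, hsplit_pi,
    logDeriv_mul_sub_one_div_two h0 h1, logDeriv_pi_cpow_neg_div_two,
    logDeriv_Gamma_comp hhalf hpole]
  ring

theorem deriv_logDeriv_xi (hs : 0 < s.re) (h1 : s ≠ 1) (hζ : riemannZeta s ≠ 0) :
    deriv (logDeriv xi) s = -(1 / s ^ 2) - 1 / (s - 1) ^ 2 + deriv digamma (s / 2) / 4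
      + deriv (logDeriv riemannZeta) s := by
  have h0 : s ≠ 0 := by
    rintro rfl
    exact hs.ne' zero_re
  have hζ_an : AnalyticAt ℂ riemannZeta s := analyticOn_riemannZeta s h1
  have heq : logDeriv xi =ᶠ[𝓝 s] fun z => z⁻¹ + (z - 1)⁻¹ - Real.log Real.pi / 2
      + digamma (z / 2) / 2 + logDeriv riemannZeta z := by
    filter_upwards [(isOpen_lt continuous_const continuous_re).mem_nhds hs,
      eventually_ne_nhds h1, hζ_an.continuousAt.eventually_ne hζ] with z hz hz1 hz2
    rw [logDeriv_xi hz hz1 hz2, one_div, one_div]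
  have hψ : HasDerivAt (fun z => digamma (z / 2)) (deriv digamma (s / 2) * (1 / 2)) s :=
    (analyticAt_digamma (ne_neg_natCast_of_re_pos (by simpa using hs))).differentiableAt.hasDerivAt
      |>.comp s ((hasDerivAt_id s).div_const 2)
  have h := (((((hasDerivAt_id' s).fun_inv h0).add
    (((hasDerivAt_id' s).sub_const 1).fun_inv (sub_ne_zero.2 h1))).sub_const
      (Real.log Real.pi / 2 : ℂ)).add (hψ.div_const 2)).add
        (analyticAt_logDeriv hζ_an hζ).differentiableAt.hasDerivAt
  rw [heq.deriv_eq]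
  refine h.deriv.trans ?_
  ring

theorem xi_one_half_ne_zero : xi (1 / 2) ≠ 0 := by
  simpa using xi_ofReal_ne_zero (1 / 2)

theorem logDeriv_xi_one_half : logDeriv xi (1 / 2) = 0 := by
  have hderiv : HasDerivAt (fun s => xi (1 - s)) (-deriv xi (1 - 1 / 2)) (1 / 2) :=
    (differentiable_xi _).hasDerivAt.comp_const_sub 1 (1 / 2)
  rw [funext xi_one_sub, sub_half] at hderiv
  rw [logDeriv_apply, self_eq_neg.1 hderiv.deriv, zero_div]

theorem deriv_logDeriv_Xi_zero : deriv (logDeriv Xi) 0 = -deriv (logDeriv xi) (1 / 2) := by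
  have haffine : ∀ t : ℂ, HasDerivAt (fun t : ℂ => 1 / 2 + I * t) I t := fun t => by
    simpa using ((hasDerivAt_id t).const_mul I).const_add (1 / 2)
  have hcomp : logDeriv Xi = fun t => logDeriv xi (1 / 2 + I * t) * I := by
    ext t
    have h := logDeriv_comp (f := xi) (differentiable_xi _) (haffine t).differentiableAt
    rwa [(haffine t).deriv] at h
  have hxi : HasDerivAt (logDeriv xi) (deriv (logDeriv xi) (1 / 2)) (1 / 2 + I * 0) := by
    rw [mul_zero, add_zero]
    exact (analyticAt_logDeriv (differentiable_xi.analyticAt _)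
      xi_one_half_ne_zero).differentiableAt.hasDerivAt
  rw [hcomp]
  refine ((hxi.comp 0 (haffine 0)).mul_const I).deriv.trans ?_
  rw [mul_assoc, I_mul_I, mul_neg_one]

theorem riemannZeta_one_half_ne_zero : riemannZeta (1 / 2) ≠ 0 := fun h =>
  xi_one_half_ne_zero <| by
    rw [xi_eq_of_re_pos (by norm_num) (by norm_num), h, mul_zero]

theorem logDeriv_riemannZeta_one_half : logDeriv riemannZeta (1 / 2) =
    ((Real.pi / 4 + Real.eulerMascheroniConstant / 2 + Real.log (8 * Real.pi) / 2 : ℝ) : ℂ) := by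
  have hsum := logDeriv_xi (s := 1 / 2) (by norm_num) (by norm_num) riemannZeta_one_half_ne_zero
  rw [logDeriv_xi_one_half, show (1 / 2 / 2 : ℂ) = 1 / 4 by norm_num, digamma_one_fourth] at hsum
  have hlog : Real.log (8 * Real.pi) = 3 * Real.log 2 + Real.log Real.pi := by
    rw [Real.log_mul (by norm_num) Real.pi_ne_zero, show (8 : ℝ) = 2 ^ 3 by norm_num,
      Real.log_pow, Nat.cast_ofNat]
  rw [hlog]
  push_cast at hsum ⊢
  linear_combination -hsum

theorem deriv_logDeriv_riemannZeta_one_half : deriv (logDeriv riemannZeta) (1 / 2) =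
    ((8 - Real.pi ^ 2 / 4 - 2 * catalanConstant : ℝ) : ℂ) - deriv (logDeriv Xi) 0 := by
  have hψ : deriv digamma (1 / 4) = ((Real.pi ^ 2 + 8 * catalanConstant : ℝ) : ℂ) := by
    rw [← tsum_one_div_natCast_add_one_fourth_sq, ← deriv_digamma_ofReal (by norm_num)]
    norm_num
  have hsum := deriv_logDeriv_xi (s := 1 / 2) (by norm_num) (by norm_num)
    riemannZeta_one_half_ne_zero
  rw [show (1 / 2 / 2 : ℂ) = 1 / 4 by norm_num, hψ] at hsum
  rw [deriv_logDeriv_Xi_zero]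
  push_cast at hsum ⊢
  linear_combination -hsum

end LogDerivXi

namespace IsXiZeroSequence

variable {α : ℕ → ℂ}

theorem isZeroFamily_sumElim_neg (hα : IsXiZeroSequence α) :
    IsZeroFamily Xi (Sum.elim α (-α)) :=
  _root_.isZeroFamily_sumElim_neg even_Xi (fun _ => Xi_ne_zero_of_re_eq_zero) hα.re_pos
    hα.multiplicity

theorem summable_sumElim (hα : IsXiZeroSequence α) :
    Summable fun i => 1 / Sum.elim α (-α) i ^ 2 :=
  hα.isZeroFamily_sumElim_neg.summable_one_div_sq differentiable_Xi
    (Xi_ne_zero_of_re_eq_zero Complex.zero_re) (p := 3 / 2) (by norm_num) (by norm_num)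
    (hasExpGrowth_Xi (by norm_num))

theorem summable_one_div_sq (hα : IsXiZeroSequence α) : Summable fun n => 1 / α n ^ 2 := by
  have h := hα.summable_sumElim.comp_injective Sum.inl_injective
  exact h

theorem deriv_logDeriv_Xi_zero_eq (hα : IsXiZeroSequence α) :
    deriv (logDeriv Xi) 0 = -(2 * ∑' n, 1 / α n ^ 2) := by
  have hpos := hα.summable_sumElim.comp_injective Sum.inl_injective
  have hneg := hα.summable_sumElim.comp_injective Sum.inr_injective
  rw [hα.isZeroFamily_sumElim_neg.deriv_logDeriv_eq_neg_tsum differentiable_Xi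
    (Xi_ne_zero_of_re_eq_zero Complex.zero_re) (p := 3 / 2) (by norm_num) (by norm_num)
    (hasExpGrowth_Xi (by norm_num)), Summable.tsum_sum hpos hneg]
  simp only [Sum.elim_inl, Sum.elim_inr, Pi.neg_apply, even_two.neg_pow, two_mul]

end IsXiZeroSequence

theorem mainTheorem1 :
    riemannZeta (1 / 2) ≠ 0 ∧
    deriv riemannZeta (1 / 2) / riemannZeta (1 / 2) =
      ((Real.pi / 4 + Real.eulerMascheroniConstant / 2 + Real.log (8 * Real.pi) / 2 : ℝ) : ℂ) ∧
    (∃ α : ℕ → ℂ, IsXiZeroSequence α) ∧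
    ∀ α : ℕ → ℂ, IsXiZeroSequence α →
      Summable (fun n : ℕ => 1 / α n ^ 2) ∧
      deriv (deriv riemannZeta) (1 / 2) / riemannZeta (1 / 2) -
          (deriv riemannZeta (1 / 2) / riemannZeta (1 / 2)) ^ 2 =
        ((8 - Real.pi ^ 2 / 4 - 2 * catalanConstant : ℝ) : ℂ) + 2 * ∑' n : ℕ, 1 / α n ^ 2 := by
  refine ⟨riemannZeta_one_half_ne_zero, logDeriv_riemannZeta_one_half, exists_isXiZeroSequence,
    fun α hα => ⟨hα.summable_one_div_sq, ?_⟩⟩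
  rw [← deriv_logDeriv_eq (analyticOn_riemannZeta _ (by norm_num : (1 / 2 : ℂ) ≠ 1))
    riemannZeta_one_half_ne_zero, deriv_logDeriv_riemannZeta_one_half,
    hα.deriv_logDeriv_Xi_zero_eq, sub_neg_eq_add]
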